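/- Identify the plane with $\mathbb{C}$. Let $P,P'\subset\mathbb{C}$ be simple polygons (closed topological disks bounded by closed polygonal lines) with vertex sets $\mathcal V_P,\mathcal V_{P'}$, and let $I=\{1,\dots,m\}$. Let $\mathcal S=\{S_1,\dots,S_m\}$ and $\mathcal S'=\{S'_1,\dots,S'_m\}$ be systems of contracting similarities $z\mapsto q e^{i\alpha}(z-c)+c$ with $0<q<1$; write $P_k=S_k(P)$, $\mathcal V_{P_k}=S_k(\mathcal V_P)$ (and $P'_k$, $\mathcal V_{P'_k}$ for $\mathcal S'$, $P'$) and $S_{\mathbf i}=S_{i_1}\circ\cdots\circ S_{i_k}$ for a non-empty multiindex $\mathbf i=i_1\dots i_k$. A system $\mathcal S$ is a *generalized $P$-polygonal system* if (D2) $P_i\cap P_j=\mathcal V_{P_i}\cap\mathcal V_{P_j}$ and $\#(\mathcal V_{P_i}\cap\mathcal V_{P_j})<2$ for all $i\ne j$; (D3) $\mathcal V_P\subset\bigcup_k\mathcal V_{P_k}$; (D4) $\bigcup_kP_k$ is contractible. It is a *contractible $P$-polygonal system* if moreover (D1) $P_k\subset P$ for all $k$. For $\delta>0$, a generalized $P'$-polygonal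 system $\mathcal S'$ is a *$\delta$-deformation* of $\mathcal S$ if there is a bijection $f:\bigcup_k\mathcal V_{P_k}\to\bigcup_k\mathcal V_{P'_k}$ such that $f|_{\mathcal V_P}$ extends to a homeomorphism $P\to P'$, $|f(x)-x|<\delta$ for all $x\in\bigcup_k\mathcal V_{P_k}$, and $f(S_k(x))=S'_k(f(x))$ for all $k\in I$, $x\in\mathcal V_P$. The attractor $K'$ of $\mathcal S'$ is the non-empty compact set with $K'=\bigcup_kS'_k(K')$; a dendrite is a locally connected continuum containing no simple closed curve. A vertex $A\in\mathcal V_{P'}$ is *cyclic* if $S'_{\mathbf i}(A)=A$ for some non-empty multiindex $\mathbf i$. A *parameter* of a cyclic vertex $A$ is a number $\lambda=\alpha/\ln r$ where, for some non-empty multiindex $\mathbf i$, $S'_{\mathbf i}(z)=re^{i\alpha}(z-A)+A$, $r>0$, and the value $\alpha$ of the rotation angle (a priori defined only modulo $2\pi$) is the total increment of a continuous argument of $z-A$ along some path in $K'\setminus\{A\}$ leading from some point $x$ to its image $S'_{\mathbf i}(x)$. **Theorem.** Let the generalized $P'$-polygonal system $\mathcal S'$ be a $\delta$-deformation, for some $\delta>0$,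 of a contractible $P$-polygonal system $\mathcal S$, and let the attractor $K'$ of $\mathcal S'$ be a dendrite. Then $\mathcal S'$ satisfies the parameter matching condition: every cyclic vertex $A\in\mathcal V_{P'}$ has exactly one parameter $\lambda_A$, and if $B\in\bigcup_k\mathcal V_{P'_k}$, $A,A'$ are cyclic vertices, and $S'_{\mathbf i}(A)=S'_{\mathbf j}(A')=B$ for some non-empty multiindices $\mathbf i,\mathbf j$, then $\lambda_A=\lambda_{A'}$. -/

import Mathlib

noncomputable section

namespace PolygonalSystem

/-! ### Polygons in the plane `ℂ` -/

/-- The vertex set of a polygon. -/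
def vertexSet {n : ℕ} (P : Polygon ℂ n) : Set ℂ := Set.range P.vertices

/-- The closed polygonal line is a simple closed curve: at least three vertices, pairwise
distinct, and two different edges meet only in their common endpoints. -/
def IsSimple {n : ℕ} (P : Polygon ℂ n) : Prop :=
  3 ≤ n ∧ Function.Injective P.vertices ∧
    ∀ i j : Fin n, i ≠ j →
      P.edgeSet ℝ i ∩ P.edgeSet ℝ j =
        {P.vertices i, P.vertices (finRotate n i)} ∩ {P.vertices j, P.vertices (finRotate n j)}

/-- The polygon as a subset of the plane: its boundary together with all points lying in a
bounded component of the complement of the boundary. For a simple polygon this is a closed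
topological disk. -/
def region {n : ℕ} (P : Polygon ℂ n) : Set ℂ :=
  P.boundary ℝ ∪
    {z | z ∉ P.boundary ℝ ∧ Bornology.IsBounded (connectedComponentIn (P.boundary ℝ)ᶜ z)}

/-! ### Contracting similarities and systems -/

/-- A contracting (orientation preserving) similarity `z ↦ a (z - c) + c` of the plane, where
`a = q e ^ (i α)` and `0 < q < 1`. -/
structure ContractingSimilarity where
  /-- the multiplier `q e ^ (i α)` -/
  mult : ℂ
  /-- the fixed point -/
  fix : ℂ
  mult_ne_zero : mult ≠ 0
  norm_mult_lt_one : ‖mult‖ < 1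

/-- The map `z ↦ a (z - c) + c`. -/
def ContractingSimilarity.toFun (s : ContractingSimilarity) (z : ℂ) : ℂ :=
  s.mult * (z - s.fix) + s.fix

instance : CoeFun ContractingSimilarity (fun _ => ℂ → ℂ) := ⟨ContractingSimilarity.toFun⟩

/-- The composition `S_{j₁} ∘ S_{j₂} ∘ ⋯ ∘ S_{jₙ}` along a multiindex `j₁ j₂ … jₙ`. -/
def wordMap {m : ℕ} (S : Fin m → ContractingSimilarity) : List (Fin m) → ℂ → ℂ
  | [], z => z
  | k :: w, z => S k (wordMap S w z)

/-- The vertices of the polygon `P_k = S_k(P)`. -/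
def pieceVertices {n m : ℕ} (P : Polygon ℂ n) (S : Fin m → ContractingSimilarity)
    (k : Fin m) : Set ℂ := S k '' vertexSet P

/-- The polygon `P_k = S_k(P)`. -/
def piece {n m : ℕ} (P : Polygon ℂ n) (S : Fin m → ContractingSimilarity)
    (k : Fin m) : Set ℂ := S k '' region P

/-- A generalized `P`-polygonal system of similarities. -/
structure IsGeneralizedPolygonalSystem {n m : ℕ} (P : Polygon ℂ n)
    (S : Fin m → ContractingSimilarity) : Prop where
  simple : IsSimple P
  inter_eq : ∀ i j, i ≠ j →
    piece P S i ∩ piece P S j = pieceVertices P S i ∩ pieceVertices P S j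
  inter_card : ∀ i j, i ≠ j → (pieceVertices P S i ∩ pieceVertices P S j).encard < 2
  vertices_subset : vertexSet P ⊆ ⋃ k, pieceVertices P S k
  contractible : ContractibleSpace (⋃ k, piece P S k : Set ℂ)

/-- A contractible `P`-polygonal system of similarities. -/
structure IsContractiblePolygonalSystem {n m : ℕ} (P : Polygon ℂ n)
    (S : Fin m → ContractingSimilarity) : Prop
    extends IsGeneralizedPolygonalSystem P S where
  piece_subset : ∀ k, piece P S k ⊆ region P

/-- The system `S'` (with polygon `P'`) is a `δ`-deformation of the system `S` (with
polygon `P`). -/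
def IsDeformation {n n' m : ℕ} (δ : ℝ) (P : Polygon ℂ n) (S : Fin m → ContractingSimilarity)
    (P' : Polygon ℂ n') (S' : Fin m → ContractingSimilarity) : Prop :=
  ∃ f : ℂ → ℂ,
    Set.BijOn f (⋃ k, pieceVertices P S k) (⋃ k, pieceVertices P' S' k) ∧
    (∃ g : region P ≃ₜ region P', ∀ x : region P, (x : ℂ) ∈ vertexSet P → (g x : ℂ) = f x) ∧
    (∀ x ∈ ⋃ k, pieceVertices P S k, ‖f x - x‖ < δ) ∧
    (∀ k, ∀ x ∈ vertexSet P, f (S k x) = S' k (f x))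

/-! ### Attractors and dendrites -/

/-- `K` is the attractor of the system `S`. -/
def IsAttractor {m : ℕ} (S : Fin m → ContractingSimilarity) (K : Set ℂ) : Prop :=
  K.Nonempty ∧ IsCompact K ∧ K = ⋃ k, S k '' K

/-- A dendrite: a locally connected continuum containing no simple closed curve. -/
def IsDendrite (K : Set ℂ) : Prop :=
  IsCompact K ∧ IsConnected K ∧ LocallyConnectedSpace K ∧
    ¬ ∃ c : Circle → ℂ, Continuous c ∧ Function.Injective c ∧ Set.range c ⊆ K

/-! ### Cyclic vertices and their parameters -/

/-- A cyclic vertex: a vertex of `P` fixed by `S_w` for some (non-empty) multiindex `w`. -/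
def IsCyclicVertex {n m : ℕ} (P : Polygon ℂ n) (S : Fin m → ContractingSimilarity)
    (A : ℂ) : Prop :=
  A ∈ vertexSet P ∧ ∃ w : List (Fin m), w ≠ [] ∧ wordMap S w A = A

/-- `α` is the angle through which `z - A` turns along some path in `K \ {A}` from a point `x`
to the point `y`: along the path `γ` one has `γ t - A = |γ t - A| e ^ (i θ t)` with a continuous
argument `θ` whose total increment is `α`. -/
def IsTurningAngle (K : Set ℂ) (A x y : ℂ) (α : ℝ) : Prop :=
  ∃ (γ : ℝ → ℂ) (θ : ℝ → ℝ),
    ContinuousOn γ (Set.Icc 0 1) ∧ ContinuousOn θ (Set.Icc 0 1) ∧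
    (∀ t ∈ Set.Icc (0 : ℝ) 1, γ t ∈ K \ {A}) ∧
    (∀ t ∈ Set.Icc (0 : ℝ) 1, γ t - A = ‖γ t - A‖ * Complex.exp (θ t * Complex.I)) ∧
    γ 0 = x ∧ γ 1 = y ∧ θ 1 - θ 0 = α

/-- `lam = α / ln r` is a parameter of the cyclic vertex `A` of the system `S` with attractor
`K`. Here `S_w(z) = r e ^ (i α) (z - A) + A` for some multiindex `w`, and among all the values of
the rotation angle of `S_w`, which differ by multiples of `2π`, the value `α` is the one given by
the geometry of the system: it is the angle through which a path in `K \ {A}` from a point `x` to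
its image `S_w(x)` turns around `A`. -/
def IsParameter {m : ℕ} (S : Fin m → ContractingSimilarity) (K : Set ℂ) (A : ℂ)
    (lam : ℝ) : Prop :=
  ∃ (w : List (Fin m)) (r α : ℝ), w ≠ [] ∧ 0 < r ∧
    (∀ z, wordMap S w z = r * Complex.exp (α * Complex.I) * (z - A) + A) ∧
    (∃ x, IsTurningAngle K A x (wordMap S w x) α) ∧
    lam = α / Real.log r

/-- The parameter matching condition for the system `S` with attractor `K`: every cyclic vertex
`A` has a well-defined parameter `λ_A`, and `λ_A = λ_{A'}` whenever `S_i(A) = S_j(A') = B` for a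
vertex `B` of one of the polygons `P_k` and some multiindices `i`, `j`. -/
def ParameterMatchingCondition {n m : ℕ} (P : Polygon ℂ n)
    (S : Fin m → ContractingSimilarity) (K : Set ℂ) : Prop :=
  (∀ A, IsCyclicVertex P S A → ∃! lam : ℝ, IsParameter S K A lam) ∧
  ∀ B ∈ ⋃ k, pieceVertices P S k, ∀ A A' : ℂ, IsCyclicVertex P S A → IsCyclicVertex P S A' →
    ∀ i j : List (Fin m), i ≠ [] → j ≠ [] → wordMap S i A = B → wordMap S j A' = B →
      ∀ lam lam' : ℝ, IsParameter S K A lam → IsParameter S K A' lam' → lam = lam'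

end PolygonalSystem

end

/-!
A connected attractor of contracting similarities is path connected: refining the segments between
its points again and again gives Cauchy sequences of paths.

If `S_w` fixes `A`, a path from `z` to `z + v` in the set of logarithms of `K - A`, with
`exp v` the multiplier of `S_w`, repeats itself under translation by `v`, so `K` contains a curve
spiralling towards `A` at the rate `v.im / v.re`, and the image of this curve spirals at the same
rate towards any image of `A`. Two curves spiralling towards the same point at different rates
cross infinitely often, on different sheets of the logarithm, and so produce a simple closed curve
around this point: in a dendrite the rates are equal. This gives both uniqueness and matching.

For existence it suffices that two points of an orbit of `S_w` lie in the same path component of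
`K \ {A}`. If there were infinitely many components, three of them would contain the legs of a triod
with centre `A`, and a triod meets every small perturbation of itself. But by compactness, among
small copies of `K` in many different components two would be close to each other relative to
their size, so they would intersect.
-/

namespace PolygonalSystem

open Set Metric

/-! ### Lifting through the exponential -/

theorem exists_continuous_log {X : Type*} [TopologicalSpace X] [SimplyConnectedSpace X]
    [LocallyPathConnectedSpace X] {g : X → ℂ} (hg : Continuous g) (hg₀ : ∀ x, g x ≠ 0)
    {x₀ : X} {e₀ : ℂ} (he : Complex.exp e₀ = g x₀) :
    ∃ f : X → ℂ, Continuous f ∧ f x₀ = e₀ ∧ ∀ x, Complex.exp (f x) = g x := by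
  obtain ⟨f, ⟨hfx₀, hf⟩, -⟩ := Complex.isCoveringMapOn_exp.existsUnique_continuousMap_lifts
    (⟨g, hg⟩ : C(X, ℂ)) he hg₀
  exact ⟨f, f.continuous, hfx₀, congrFun hf⟩

theorem eq_of_exp_eq {X : Type*} [TopologicalSpace X] [PreconnectedSpace X] {f g : X → ℂ}
    (hf : Continuous f) (hg : Continuous g) (h : ∀ x, Complex.exp (f x) = Complex.exp (g x))
    {x₀ : X} (hx₀ : f x₀ = g x₀) : f = g :=
  Complex.isCoveringMap_exp.eq_of_comp_eq hf hg (funext fun x => Subtype.ext (h x)) x₀ hx₀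

theorem sub_eq_sub_add_log_sub_log {X : Type*} [TopologicalSpace X] [PreconnectedSpace X]
    {f g q : X → ℂ} (hf : Continuous f) (hg : Continuous g) (hq : Continuous q)
    (hq₀ : ∀ x, q x ∈ Complex.slitPlane)
    (h : ∀ x, Complex.exp (f x) = q x * Complex.exp (g x)) (x y : X) :
    f y - f x = g y - g x + (Complex.log (q y) - Complex.log (q x)) := by
  have hlog : Continuous fun y => Complex.log (q y) := hq.clog hq₀
  have hexp : ∀ y, Complex.exp (Complex.log (q y) + g y) = Complex.exp (f y) := fun y => by
    rw [Complex.exp_add, Complex.exp_log (Complex.slitPlane_ne_zero (hq₀ y)), h]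
  have key : f = fun y => (Complex.log (q y) + g y) + (f x - (Complex.log (q x) + g x)) := by
    refine eq_of_exp_eq hf (by fun_prop) (fun y => ?_) (x₀ := x) (by ring)
    rw [Complex.exp_add, Complex.exp_sub, hexp, hexp, div_self (Complex.exp_ne_zero _), mul_one]
  linear_combination congrFun key y

theorem sub_div_sub_mem_slitPlane {a b c : ℂ} (h : ‖c - b‖ < ‖a - b‖) :
    (a - c) / (a - b) ∈ Complex.slitPlane := by
  have hab : 0 < ‖a - b‖ := (norm_nonneg _).trans_lt h
  apply Complex.ball_one_subset_slitPlane
  rwa [mem_ball_iff_norm, div_sub_one (norm_pos_iff.1 hab), norm_div, div_lt_one hab,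
    sub_sub_sub_cancel_left, norm_sub_rev]

theorem exists_eq_of_bounded {b : ℂ → ℂ} (hb : Continuous b) {R : ℝ}
    (hR : ∀ z, ‖b z‖ ≤ R) : ∃ z, b z = z := by
  by_contra! hfix
  have hR₀ : 0 < R + 1 := by linarith [(norm_nonneg _).trans (hR 0)]
  have hne : ∀ z, z - b z ≠ 0 := fun z => sub_ne_zero.2 (hfix z).symm
  obtain ⟨L, hL, -, hLexp⟩ := exists_continuous_log (continuous_id.sub hb) hne
    (Complex.exp_log (hne 0))
  set ℓ : ℝ → ℂ := fun θ => Real.log (R + 1) + θ * Complex.I with hℓ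
  set c : ℝ → ℂ := fun θ => Complex.exp (ℓ θ) with hc
  have hcR : ∀ θ, ‖c θ‖ = R + 1 := fun θ => by simp [hc, hℓ, Complex.norm_exp, Real.exp_log hR₀]
  have hcont : Continuous c := by fun_prop
  have hslit : ∀ θ, (c θ - b (c θ)) / (c θ - 0) ∈ Complex.slitPlane := fun θ =>
    sub_div_sub_mem_slitPlane (by rw [sub_zero, sub_zero, hcR]; linarith [hR (c θ)])
  have hperiod : c (2 * Real.pi) = c 0 := by
    simp [hc, hℓ, Complex.exp_add]
  have hturn := sub_eq_sub_add_log_sub_log (hL.comp hcont) (g := ℓ) (by fun_prop)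
    (q := fun θ => (c θ - b (c θ)) / (c θ - 0))
    ((hcont.sub (hb.comp hcont)).div (hcont.sub continuous_const)
      fun θ => by rw [sub_zero]; exact Complex.exp_ne_zero _) hslit
    (fun θ => by rw [Function.comp_apply, hLexp, sub_zero]
                 exact (div_mul_cancel₀ _ (Complex.exp_ne_zero _)).symm) 0 (2 * Real.pi)
  simp [hperiod, hℓ] at hturn

/-! ### Arcs and simple closed curves in paths -/

/-- `C` is obtained from `[a, b]` by deleting disjoint open intervals such that `f` takes the same
value at the two ends of each of them: the parameters that survive when loops are cut out of the
path `f`. -/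
structure IsLoopErased {X : Type*} (f : ℝ → X) (a b : ℝ) (C : Set ℝ) : Prop where
  isClosed : IsClosed C
  subset_Icc : C ⊆ Icc a b
  left_mem : a ∈ C
  right_mem : b ∈ C
  eq_of_gap : ∀ s ∈ C, ∀ t ∈ C, s < t → C ∩ Ioo s t = ∅ → f s = f t

theorem isLoopErased_Icc {X : Type*} (f : ℝ → X) {a b : ℝ} (hab : a ≤ b) :
    IsLoopErased f a b (Icc a b) where
  isClosed := isClosed_Icc
  subset_Icc := subset_rfl
  left_mem := left_mem_Icc.2 hab
  right_mem := right_mem_Icc.2 hab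
  eq_of_gap s hs t ht hst h := by
    obtain ⟨u, hsu, hut⟩ := exists_between hst
    exact (h.subset ⟨⟨hs.1.trans hsu.le, hut.le.trans ht.2⟩, hsu, hut⟩).elim

theorem exists_gap_of_inter_Icc_eq_empty {C : Set ℝ} (hC : IsClosed C) {s p q t : ℝ}
    (hs : s ∈ C) (ht : t ∈ C) (hsp : s ≤ p) (hqt : q ≤ t) (h : C ∩ Icc p q = ∅) :
    ∃ s' ∈ C ∩ Icc s p, ∃ t' ∈ C ∩ Icc q t, C ∩ Ioo s' t' = ∅ := by
  obtain ⟨s', hs', hs'max⟩ :=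
    (isCompact_Icc.inter_left hC).exists_isGreatest ⟨s, hs, left_mem_Icc.2 hsp⟩
  obtain ⟨t', ht', ht'min⟩ :=
    (isCompact_Icc.inter_left hC).exists_isLeast ⟨t, ht, right_mem_Icc.2 hqt⟩
  refine ⟨s', hs', t', ht', eq_empty_of_forall_notMem ?_⟩
  rintro x ⟨hx, hsx, hxt⟩
  rcases le_or_gt x p with hxp | hpx
  · exact hsx.not_ge (hs'max ⟨hx, hs'.2.1.trans hsx.le, hxp⟩)
  rcases le_or_gt q x with hqx | hxq
  · exact hxt.not_ge (ht'min ⟨hx, hqx, hxt.le.trans ht'.2.2⟩)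
  · exact (h.subset ⟨hx, hpx.le, hxq.le⟩).elim

theorem exists_mem_inter_eq_empty_of_isChain {X : Type*} [TopologicalSpace X] {c : Set (Set X)}
    (hc : ∀ C ∈ c, IsClosed C) (hchain : IsChain (· ⊆ ·) c) (hne : c.Nonempty) {Q : Set X}
    (hQ : IsCompact Q) (h : ⋂₀ c ∩ Q = ∅) : ∃ C ∈ c, C ∩ Q = ∅ := by
  have := hne.to_subtype
  obtain ⟨⟨C, hC⟩, hCQ⟩ := hQ.elim_directed_family_closed (fun C : c => (C : Set X))
    (fun C => hc _ C.2) (by rwa [← sInter_eq_iInter, inter_comm])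
    (fun A B => (hchain.total A.2 B.2).elim (fun h => ⟨A, subset_rfl, h⟩)
      fun h => ⟨B, h, subset_rfl⟩)
  exact ⟨C, hC, by rwa [inter_comm]⟩

theorem isLoopErased_sInter {X : Type*} [TopologicalSpace X] [T2Space X] {f : ℝ → X} {a b : ℝ}
    (hf : ContinuousOn f (Icc a b)) {c : Set (Set ℝ)} (hc : ∀ C ∈ c, IsLoopErased f a b C)
    (hchain : IsChain (· ⊆ ·) c) (hne : c.Nonempty) : IsLoopErased f a b (⋂₀ c) where
  isClosed := isClosed_sInter fun C hC => (hc C hC).isClosed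
  subset_Icc := hne.elim fun C hC => (sInter_subset_of_mem hC).trans (hc C hC).subset_Icc
  left_mem := fun C hC => (hc C hC).left_mem
  right_mem := fun C hC => (hc C hC).right_mem
  eq_of_gap s hs t ht hst h := by
    by_contra hfst
    have hI : ∀ {u C}, C ∈ c → u ∈ C → u ∈ Icc a b := fun hC hu => (hc _ hC).subset_Icc hu
    obtain ⟨C₀, hC₀⟩ := hne
    obtain ⟨U, V, hU, hV, hUV⟩ := t2_separation_nhds hfst
    obtain ⟨η₁, hη₁, h₁⟩ := mem_nhdsWithin_iff.1 (hf s (hI hC₀ (hs _ hC₀)) hU)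
    obtain ⟨η₂, hη₂, h₂⟩ := mem_nhdsWithin_iff.1 (hf t (hI hC₀ (ht _ hC₀)) hV)
    obtain ⟨p, hsp, hp⟩ := exists_between (lt_min (lt_add_of_pos_right s hη₁) hst)
    have hpt : p < t := hp.trans_le (min_le_right ..)
    obtain ⟨q, hq, hqt⟩ := exists_between (max_lt (sub_lt_self t hη₂) hpt)
    simp only [lt_min_iff, max_lt_iff] at hp hq
    obtain ⟨C, hC, hCpq⟩ := exists_mem_inter_eq_empty_of_isChain
      (fun C hC => (hc C hC).isClosed) hchain ⟨C₀, hC₀⟩ (isCompact_Icc (a := p) (b := q))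
      (subset_eq_empty (inter_subset_inter_right _ (Icc_subset_Ioo hsp hqt)) h)
    obtain ⟨s', ⟨hs'C, hs'⟩, t', ⟨ht'C, ht'⟩, hgap⟩ := exists_gap_of_inter_Icc_eq_empty
      (hc C hC).isClosed (hs C hC) (ht C hC) hsp.le hqt.le hCpq
    have hs'U : f s' ∈ U := h₁ ⟨by
      rw [mem_ball, Real.dist_eq, abs_lt]; constructor <;> linarith [hs'.1, hs'.2], hI hC hs'C⟩
    have ht'V : f t' ∈ V := h₂ ⟨by
      rw [mem_ball, Real.dist_eq, abs_lt]; constructor <;> linarith [ht'.1, ht'.2], hI hC ht'C⟩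
    have heq : f s' = f t' := (hc C hC).eq_of_gap s' hs'C t' ht'C
      (hs'.2.trans_lt (hq.2.trans_le ht'.1)) hgap
    exact disjoint_left.1 hUV hs'U (heq ▸ ht'V)

theorem IsLoopErased.diff_Ioo {X : Type*} {f : ℝ → X} {a b : ℝ} {C : Set ℝ}
    (hC : IsLoopErased f a b C) {s t : ℝ} (hs : s ∈ C) (ht : t ∈ C) (h : f s = f t) :
    IsLoopErased f a b (C \ Ioo s t) where
  isClosed := hC.isClosed.sdiff isOpen_Ioo
  subset_Icc := sdiff_subset.trans hC.subset_Icc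
  left_mem := ⟨hC.left_mem, fun h => h.1.not_ge (hC.subset_Icc hs).1⟩
  right_mem := ⟨hC.right_mem, fun h => h.2.not_ge (hC.subset_Icc ht).2⟩
  eq_of_gap u hu v hv huv hgap := by
    have hgap' : ∀ x ∈ C, x ∉ Ioo s t → x ∉ Ioo u v := fun x hx hxst hxuv =>
      (hgap.subset ⟨⟨hx, hxst⟩, hxuv⟩).elim
    by_cases hdisj : ∃ x, x ∈ Ioo s t ∩ Ioo u v
    · obtain ⟨x, hxst, hxuv⟩ := hdisj
      have hus : u ≤ s := by
        by_contra! hsu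
        exact hu.2 ⟨hsu, hxuv.1.trans hxst.2⟩
      have htv : t ≤ v := by
        by_contra! hvt
        exact hv.2 ⟨hxst.1.trans hxuv.2, hvt⟩
      obtain rfl : u = s := hus.eq_of_not_lt fun hus =>
        hgap' s hs (fun h => h.1.false) ⟨hus, hxst.1.trans hxuv.2⟩
      obtain rfl : t = v := htv.eq_of_not_lt fun htv =>
        hgap' t ht (fun h => h.2.false) ⟨hxuv.1.trans hxst.2, htv⟩
      exact h
    · refine hC.eq_of_gap u hu.1 v hv.1 huv (eq_empty_of_forall_notMem fun x hx => ?_)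
      exact hgap' x hx.1 (fun hxst => hdisj ⟨x, hxst, hx.2⟩) hx.2

theorem exists_isLoopErased_minimal {X : Type*} [TopologicalSpace X] [T2Space X] {f : ℝ → X}
    {a b : ℝ} (hab : a ≤ b) (hf : ContinuousOn f (Icc a b)) :
    ∃ C, IsLoopErased f a b C ∧
      ∀ s ∈ C, ∀ t ∈ C, f s = f t → C ∩ Ioo s t = ∅ := by
  obtain ⟨C, -, hC⟩ := zorn_superset_nonempty {C | IsLoopErased f a b C}
    (fun c hc hchain hne =>
      ⟨⋂₀ c, isLoopErased_sInter hf hc hchain hne, fun s hs => sInter_subset_of_mem hs⟩)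
    (Icc a b) (isLoopErased_Icc f hab)
  refine ⟨C, hC.prop, fun s hs t ht h => eq_empty_of_forall_notMem fun x hx => ?_⟩
  exact (hC.le_of_le (hC.prop.diff_Ioo hs ht h) sdiff_subset hx.1).2 hx.2

/-- The proximity of a sequence `x` to a set `E`. For a dense sequence this is a bounded, strictly
monotone measure of the size of non-empty closed sets, continuous in the Hausdorff distance. -/
noncomputable def proximity {X : Type*} [PseudoMetricSpace X] (x : ℕ → X) (E : Set X) : ℝ :=
  ∑' n, (1 / 2 : ℝ) ^ n * (1 - min 1 (infDist (x n) E))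

section Proximity

variable {X : Type*} [PseudoMetricSpace X] {x : ℕ → X} {E F : Set X}

theorem summable_proximity (x : ℕ → X) (E : Set X) :
    Summable fun n => (1 / 2 : ℝ) ^ n * (1 - min 1 (infDist (x n) E)) := by
  refine Summable.of_nonneg_of_le (fun n => ?_) (fun n => ?_) summable_geometric_two
  · exact mul_nonneg (by positivity) (sub_nonneg.2 (min_le_left _ _))
  · exact mul_le_of_le_one_right (by positivity)
      (sub_le_self _ (le_min zero_le_one infDist_nonneg))

theorem proximity_mono (hE : E.Nonempty) (h : E ⊆ F) : proximity x E ≤ proximity x F := by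
  refine Summable.tsum_le_tsum (fun n => ?_) (summable_proximity x E) (summable_proximity x F)
  gcongr
  exact infDist_le_infDist_of_subset h hE

theorem proximity_lt_proximity (hx : DenseRange x) (hE : E.Nonempty) (hEc : IsClosed E)
    (h : E ⊆ F) {y : X} (hyF : y ∈ F) (hyE : y ∉ E) : proximity x E < proximity x F := by
  have hd : 0 < infDist y E := (hEc.notMem_iff_infDist_pos hE).1 hyE
  obtain ⟨n, hn⟩ := hx.exists_dist_lt y (show 0 < min 1 (infDist y E) / 3 by positivity)
  refine Summable.tsum_lt_tsum (i := n) (fun n => ?_) ?_ (summable_proximity x E)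
    (summable_proximity x F)
  · gcongr
    exact infDist_le_infDist_of_subset h hE
  · have hF : infDist (x n) F ≤ dist (x n) y := infDist_le_dist_of_mem hyF
    have hyE : infDist y E ≤ infDist (x n) E + dist y (x n) := infDist_le_infDist_add_dist
    rw [dist_comm (x n)] at hF
    have h1 := min_le_left 1 (infDist y E)
    have h2 := min_le_right 1 (infDist y E)
    gcongr 2
    rw [lt_min_iff]
    constructor <;> exact (min_le_right _ _).trans_lt (by linarith)

theorem proximity_le_proximity_add (hF : F.Nonempty) {δ : ℝ}
    (h : ∀ y ∈ F, ∃ z ∈ E, dist y z ≤ δ) :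
    proximity x F ≤ proximity x E + 2 * δ := by
  have hδ : 0 ≤ δ := by
    obtain ⟨y, hy⟩ := hF
    obtain ⟨z, -, hz⟩ := h y hy
    exact dist_nonneg.trans hz
  have hdist : ∀ n, infDist (x n) E ≤ infDist (x n) F + δ := fun n => by
    rw [← sub_le_iff_le_add, le_infDist hF]
    intro y hy
    obtain ⟨z, hz, hyz⟩ := h y hy
    linarith [dist_triangle (x n) y z, infDist_le_dist_of_mem hz (x := x n)]
  have hsum : Summable fun n : ℕ => (1 / 2 : ℝ) ^ n * δ := summable_geometric_two.mul_right δ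
  have htsum : ∑' n : ℕ, (1 / 2 : ℝ) ^ n * δ = 2 * δ := by
    rw [tsum_mul_right, tsum_geometric_two]
  rw [← htsum, proximity, proximity, ← (summable_proximity x E).tsum_add hsum]
  refine Summable.tsum_le_tsum (fun n => ?_) (summable_proximity x F)
    ((summable_proximity x E).add hsum)
  rw [← mul_add]
  gcongr
  have : min 1 (infDist (x n) E) ≤ min 1 (infDist (x n) F) + δ := by
    rw [← min_add_add_right]
    exact min_le_min (by linarith) (hdist n)
  linarith

end Proximity

section Trace

variable {X : Type*} {f : ℝ → X} {a : ℝ} {C : Set ℝ}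

theorem image_inter_Icc_eq_iff (hC : ∀ s ∈ C, ∀ t ∈ C, f s = f t → C ∩ Ioo s t = ∅) {s t : ℝ}
    (hs : s ∈ C) (ht : t ∈ C) (has : a ≤ s) (hst : s ≤ t) :
    f '' (C ∩ Icc a s) = f '' (C ∩ Icc a t) ↔ f s = f t := by
  constructor
  · intro h
    obtain ⟨u, ⟨hu, -, hus⟩, hut⟩ : f t ∈ f '' (C ∩ Icc a s) :=
      h ▸ mem_image_of_mem f ⟨ht, has.trans hst, le_rfl⟩
    rcases hus.eq_or_lt with rfl | hus
    · exact hut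
    rcases hst.eq_or_lt with rfl | hst
    · rfl
    · exact ((hC u hu t ht hut).subset ⟨hs, hus, hst⟩).elim
  · intro h
    refine Subset.antisymm (image_mono (inter_subset_inter_right _ (Icc_subset_Icc_right hst))) ?_
    rintro _ ⟨u, ⟨hu, hau, hut⟩, rfl⟩
    rcases le_or_gt u s with hus | hsu
    · exact ⟨u, ⟨hu, hau, hus⟩, rfl⟩
    rcases hut.eq_or_lt with rfl | hut
    · exact ⟨s, ⟨hs, has, le_rfl⟩, h⟩
    · exact ((hC s hs t ht h).subset ⟨hu, hsu, hut⟩).elim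

variable [MetricSpace X] {x : ℕ → X}

theorem proximity_image_eq_iff (hx : DenseRange x) (hCc : IsCompact C) (hCa : C ⊆ Ici a)
    (hf : ContinuousOn f C) (hC : ∀ s ∈ C, ∀ t ∈ C, f s = f t → C ∩ Ioo s t = ∅) {s t : ℝ}
    (hs : s ∈ C) (ht : t ∈ C) :
    proximity x (f '' (C ∩ Icc a s)) = proximity x (f '' (C ∩ Icc a t)) ↔ f s = f t := by
  wlog hst : s ≤ t generalizing s t
  · rw [eq_comm, this ht hs (le_of_not_ge hst), eq_comm]
  rw [← image_inter_Icc_eq_iff hC hs ht (hCa hs) hst]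
  refine ⟨fun h => ?_, fun h => by rw [h]⟩
  have hsub : f '' (C ∩ Icc a s) ⊆ f '' (C ∩ Icc a t) :=
    image_mono (inter_subset_inter_right _ (Icc_subset_Icc_right hst))
  refine hsub.antisymm fun y hyt => ?_
  by_contra hys
  have hne : (f '' (C ∩ Icc a s)).Nonempty := ⟨f s, s, ⟨hs, hCa hs, le_rfl⟩, rfl⟩
  refine (proximity_lt_proximity hx hne ?_ hsub hyt hys).ne h
  exact ((hCc.inter_right isClosed_Icc).image_of_continuousOn
    (hf.mono inter_subset_left)).isClosed

theorem continuousOn_proximity_image (hCc : IsCompact C) (hCa : C ⊆ Ici a)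
    (hf : ContinuousOn f C) :
    ContinuousOn (fun t => proximity x (f '' (C ∩ Icc a t))) C := by
  have hne : ∀ t ∈ C, (f '' (C ∩ Icc a t)).Nonempty := fun t ht =>
    ⟨f t, mem_image_of_mem f ⟨ht, hCa ht, le_rfl⟩⟩
  have hunif := Metric.uniformContinuousOn_iff.1 (hCc.uniformContinuousOn_of_continuous hf)
  refine Metric.continuousOn_iff.2 fun s hs ε hε => ?_
  obtain ⟨δ, hδ, h⟩ := hunif (ε / 3) (by positivity)
  refine ⟨δ, hδ, fun t ht hts => ?_⟩
  wlog hle : s ≤ t generalizing s t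
  · rw [dist_comm] at hts ⊢
    exact this t ht s hs hts (le_of_not_ge hle)
  have hmono := proximity_mono (x := x) (hne s hs) (image_mono (f := f)
    (inter_subset_inter_right C (Icc_subset_Icc_right hle)))
  have hadd : proximity x (f '' (C ∩ Icc a t)) ≤
      proximity x (f '' (C ∩ Icc a s)) + 2 * (ε / 3) := by
    refine proximity_le_proximity_add (hne t ht) ?_
    rintro _ ⟨u, ⟨hu, hau, hut⟩, rfl⟩
    rcases le_or_gt u s with hus | hsu
    · exact ⟨f u, ⟨u, ⟨hu, hau, hus⟩, rfl⟩, by rw [dist_self]; positivity⟩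
    · refine ⟨f s, ⟨s, ⟨hs, hCa hs, le_rfl⟩, rfl⟩, (h u hu s hs ?_).le⟩
      rw [Real.dist_eq, abs_lt] at hts ⊢
      constructor <;> linarith
  rw [Real.dist_eq, abs_lt]
  constructor <;> linarith

end Trace

theorem IsLoopErased.Icc_subset_image {m : ℝ → ℝ} {a b : ℝ} {C : Set ℝ}
    (hC : IsLoopErased m a b C) (hm : ContinuousOn m C) : Icc (m a) (m b) ⊆ m '' C := by
  intro v hv
  have hCc : IsCompact C := isCompact_Icc.of_isClosed_subset hC.isClosed hC.subset_Icc
  have hcompact : ∀ {J : Set ℝ}, IsClosed J → IsCompact (C ∩ m ⁻¹' J) := fun hJ =>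
    hCc.of_isClosed_subset (hm.preimage_isClosed_of_isClosed hC.isClosed hJ) inter_subset_left
  obtain ⟨s, ⟨hs, hsv⟩, hsmax⟩ :=
    (hcompact isClosed_Iic).exists_isGreatest ⟨a, hC.left_mem, hv.1⟩
  obtain ⟨t, ⟨⟨ht, hvt⟩, hst⟩, htmin⟩ :=
    ((hcompact isClosed_Ici).inter_right isClosed_Ici).exists_isLeast
      ⟨b, ⟨hC.right_mem, hv.2⟩, (hC.subset_Icc hs).2⟩
  refine ⟨s, hs, le_antisymm hsv ?_⟩
  rcases (show s ≤ t from hst).eq_or_lt with rfl | hst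
  · exact hvt
  rw [hC.eq_of_gap s hs t ht hst (eq_empty_of_forall_notMem ?_)]
  · exact hvt
  rintro u ⟨hu, hsu, hut⟩
  rcases le_total (m u) v with h | h
  · exact (hsmax ⟨hu, h⟩).not_gt hsu
  · exact (htmin ⟨⟨hu, h⟩, hsu.le⟩).not_gt hut

theorem exists_continuousOn_factor {X Y Z : Type*} [Nonempty X] [TopologicalSpace X]
    [TopologicalSpace Y] [T2Space Y] [TopologicalSpace Z] {C : Set X} (hC : IsCompact C)
    {m : X → Y} {f : X → Z} (hm : ContinuousOn m C) (hf : ContinuousOn f C)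
    (h : ∀ s ∈ C, ∀ t ∈ C, m s = m t → f s = f t) :
    ∃ g : Y → Z, ContinuousOn g (m '' C) ∧ ∀ t ∈ C, g (m t) = f t := by
  have hg : ∀ t ∈ C, f (Function.invFunOn m C (m t)) = f t := fun t ht =>
    h _ (Function.invFunOn_apply_mem ht) t ht (Function.invFunOn_apply_eq ht)
  refine ⟨f ∘ Function.invFunOn m C, continuousOn_iff_isClosed.2 fun F hF => ?_, hg⟩
  obtain ⟨G, hG, hGF⟩ := continuousOn_iff_isClosed.1 hf F hF
  refine ⟨m '' (C ∩ G), ((hC.inter_right hG).image_of_continuousOn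
    (hm.mono inter_subset_left)).isClosed, ?_⟩
  ext y
  constructor
  · rintro ⟨hy, t, ht, rfl⟩
    have : t ∈ f ⁻¹' F ∩ C := ⟨by rwa [mem_preimage, ← hg t ht], ht⟩
    exact ⟨⟨t, ⟨ht, (hGF ▸ this).1⟩, rfl⟩, t, ht, rfl⟩
  · rintro ⟨⟨t, ⟨ht, htG⟩, rfl⟩, hy⟩
    have : t ∈ G ∩ C := ⟨htG, ht⟩
    refine ⟨?_, hy⟩
    rw [mem_preimage, Function.comp_apply, hg t ht]
    exact (hGF ▸ this).1

theorem exists_arc_of_path {X : Type*} [MetricSpace X] [TopologicalSpace.SeparableSpace X]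
    {f : ℝ → X} {a b : ℝ} (hab : a ≤ b) (hf : ContinuousOn f (Icc a b)) (hne : f a ≠ f b) :
    ∃ g : ℝ → X, ContinuousOn g (Icc 0 1) ∧ InjOn g (Icc 0 1) ∧ g 0 = f a ∧ g 1 = f b ∧
      g '' Icc 0 1 ⊆ f '' Icc a b := by
  obtain ⟨C, hC, hmin⟩ := exists_isLoopErased_minimal hab hf
  have hCc : IsCompact C := isCompact_Icc.of_isClosed_subset hC.isClosed hC.subset_Icc
  have hCa : C ⊆ Ici a := fun t ht => (hC.subset_Icc ht).1
  have hfC := hf.mono hC.subset_Icc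
  have : Nonempty X := ⟨f a⟩
  set m : ℝ → ℝ := fun t =>
    proximity (TopologicalSpace.denseSeq X) (f '' (C ∩ Icc a t))
  have hmf : ∀ s ∈ C, ∀ t ∈ C, (m s = m t ↔ f s = f t) := fun s hs t ht =>
    proximity_image_eq_iff (TopologicalSpace.denseRange_denseSeq X) hCc hCa hfC hmin hs ht
  have hmcont : ContinuousOn m C := continuousOn_proximity_image hCc hCa hfC
  obtain ⟨g, hg, hgm⟩ := exists_continuousOn_factor hCc hmcont hfC
    fun s hs t ht => (hmf s hs t ht).1
  have hmab : m a < m b := by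
    refine lt_of_le_of_ne (proximity_mono ⟨f a, a, ⟨hC.left_mem, le_rfl, le_rfl⟩, rfl⟩ ?_)
      fun h => hne ((hmf a hC.left_mem b hC.right_mem).1 h)
    exact image_mono (inter_subset_inter_right _ (Icc_subset_Icc_right hab))
  have hsurj : Icc (m a) (m b) ⊆ m '' C := IsLoopErased.Icc_subset_image
    { hC with eq_of_gap := fun s hs t ht hst hgap =>
        (hmf s hs t ht).2 (hC.eq_of_gap s hs t ht hst hgap) } hmcont
  have hline : ∀ t ∈ Icc (0 : ℝ) 1, AffineMap.lineMap (m a) (m b) t ∈ m '' C := fun t ht =>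
    hsurj (segment_eq_Icc hmab.le ▸ lineMap_mem_segment ℝ (m a) (m b) ht)
  refine ⟨g ∘ AffineMap.lineMap (m a) (m b),
    hg.comp AffineMap.lineMap_continuous.continuousOn hline, fun s hs t ht hst => ?_, ?_, ?_, ?_⟩
  · refine AffineMap.lineMap_injective ℝ hmab.ne ?_
    obtain ⟨s', hs', hs'm⟩ := hline s hs
    obtain ⟨t', ht', ht'm⟩ := hline t ht
    rw [← hs'm, ← ht'm, hmf s' hs' t' ht', ← hgm s' hs', ← hgm t' ht', hs'm, ht'm]
    exact hst
  · simpa using hgm a hC.left_mem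
  · simpa using hgm b hC.right_mem
  · rintro _ ⟨t, ht, rfl⟩
    obtain ⟨t', ht', ht'm⟩ := hline t ht
    exact ⟨t', hC.subset_Icc ht', by rw [← hgm t' ht', ht'm]; rfl⟩

theorem two_pi_le_norm_sub_of_exp_eq {z w : ℂ} (h : Complex.exp z = Complex.exp w)
    (hne : z ≠ w) : 2 * Real.pi ≤ ‖z - w‖ := by
  obtain ⟨n, rfl⟩ := Complex.exp_eq_exp_iff_exists_int.1 h
  have hn : n ≠ 0 := by
    rintro rfl
    simp at hne
  have hn₁ : (1 : ℝ) ≤ |(n : ℝ)| := by exact_mod_cast Int.one_le_abs hn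
  calc 2 * Real.pi ≤ |(n : ℝ)| * (2 * Real.pi) := le_mul_of_one_le_left (by positivity) hn₁
    _ = ‖w + n * (2 * Real.pi * Complex.I) - w‖ := by simp [abs_of_pos Real.pi_pos]

theorem exists_circle_of_injOn_Ico {X : Type*} [TopologicalSpace X] {f : ℝ → X} {a b : ℝ}
    (hab : a < b) (hf : ContinuousOn f (Icc a b)) (heq : f a = f b) (hinj : InjOn f (Ico a b)) :
    ∃ c : Circle → X, Continuous c ∧ Function.Injective c ∧ range c ⊆ f '' Icc a b := by
  have hpos : 0 < b - a := sub_pos.2 hab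
  have : Fact (0 < b - a) := ⟨hpos⟩
  rw [← add_sub_cancel a b] at hf heq hinj
  set e := AddCircle.homeomorphCircle hpos.ne'
  refine ⟨AddCircle.liftIco (b - a) a f ∘ e.symm,
    (AddCircle.liftIco_continuous heq hf).comp e.symm.continuous,
    (hinj.injective.comp (AddCircle.equivIco (b - a) a).injective).comp e.symm.injective, ?_⟩
  rintro _ ⟨z, rfl⟩
  obtain ⟨haz, hzb⟩ := (AddCircle.equivIco (b - a) a (e.symm z)).2
  exact ⟨_, ⟨haz, hzb.le.trans (add_sub_cancel a b).le⟩, rfl⟩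

theorem exists_injOn_exp_Ico {f : ℝ → ℂ} {a b : ℝ} (hab : a < b) (hf : ContinuousOn f (Icc a b))
    (hinj : InjOn f (Icc a b)) (hexp : Complex.exp (f a) = Complex.exp (f b)) :
    ∃ c d, a ≤ c ∧ c < d ∧ d ≤ b ∧ Complex.exp (f c) = Complex.exp (f d) ∧
      InjOn (fun t => Complex.exp (f t)) (Ico c d) := by
  set W : Set (ℂ × ℂ) :=
    {p | Complex.exp p.1 = Complex.exp p.2} ∩ {p | 2 * Real.pi ≤ ‖p.1 - p.2‖}
  have hW : IsClosed W :=
    (isClosed_eq (by fun_prop) (by fun_prop)).inter (isClosed_le (by fun_prop) (by fun_prop))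
  set Q : Set (ℝ × ℝ) := (Icc a b ×ˢ Icc a b) ∩ Prod.map f f ⁻¹' W ∩ {q | q.1 ≤ q.2}
  have hQ : IsCompact Q :=
    (isCompact_Icc.prod isCompact_Icc).of_isClosed_subset
      (((hf.prodMap hf).preimage_isClosed_of_isClosed (isClosed_Icc.prod isClosed_Icc) hW).inter
        (isClosed_le continuous_fst continuous_snd))
      (inter_subset_left.trans inter_subset_left)
  have hmem : ∀ {s t}, a ≤ s → s < t → t ≤ b → Complex.exp (f s) = Complex.exp (f t) →
      (s, t) ∈ Q := fun has hst htb he =>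
    have hs := ⟨has, hst.le.trans htb⟩
    have ht := ⟨has.trans hst.le, htb⟩
    ⟨⟨⟨hs, ht⟩, he, two_pi_le_norm_sub_of_exp_eq he fun h => hst.ne (hinj hs ht h)⟩, hst.le⟩
  obtain ⟨⟨c, d⟩, hcd, hmin⟩ := hQ.exists_isMinOn
    ⟨(a, b), hmem le_rfl hab le_rfl hexp⟩ (f := fun q : ℝ × ℝ => q.2 - q.1) (by fun_prop)
  obtain ⟨⟨⟨hc, hd⟩, he, hpi⟩, hle⟩ := hcd
  have hlt : c < d := lt_of_le_of_ne hle fun (h : c = d) => by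
    rw [h, mem_ofPred_eq, Prod.map_apply, sub_self, norm_zero] at hpi
    linarith [Real.pi_pos]
  refine ⟨c, d, hc.1, hlt, hd.2, he, fun s hs t ht hst => ?_⟩
  by_contra hne
  wlog hlt' : s < t generalizing s t
  · exact this t ht s hs hst.symm (Ne.symm hne) (lt_of_le_of_ne (not_lt.1 hlt') (Ne.symm hne))
  have : d - c ≤ t - s := hmin (hmem (hc.1.trans hs.1) hlt' (ht.2.le.trans hd.2) hst)
  linarith [hs.1, ht.2]

/-- The set of logarithms of `z - A`, where `z` runs through the points `z ≠ A` of `K`. The angles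
at which a path in `K \ {A}` is seen from `A` are the imaginary parts of a lift of this path. -/
def logLift (K : Set ℂ) (A : ℂ) : Set ℂ := {u | A + Complex.exp u ∈ K}

theorem exists_circle_of_joinedIn_logLift {K : Set ℂ} {A z w : ℂ} (h : JoinedIn (logLift K A) z w)
    (hexp : Complex.exp z = Complex.exp w) (hne : z ≠ w) :
    ∃ c : Circle → ℂ, Continuous c ∧ Function.Injective c ∧ range c ⊆ K := by
  obtain ⟨p, hp⟩ := h
  have hpe : p.extend 0 ≠ p.extend 1 := by simpa using hne
  obtain ⟨g, hg, hinj, hg₀, hg₁, hsub⟩ :=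
    exists_arc_of_path zero_le_one p.continuous_extend.continuousOn hpe
  obtain ⟨a, b, ha, hab, hb, heq, hinj'⟩ := exists_injOn_exp_Ico one_pos hg hinj
    (by simpa [hg₀, hg₁] using hexp)
  have hab' : Icc a b ⊆ Icc 0 1 := Icc_subset_Icc ha hb
  obtain ⟨c, hc, hcinj, hcsub⟩ := exists_circle_of_injOn_Ico
    (f := fun t => A + Complex.exp (g t)) hab
    (continuousOn_const.add (hg.mono hab').cexp) (by simp only [heq])
    (fun s hs t ht hst => hinj' hs ht (add_left_cancel hst))
  refine ⟨c, hc, hcinj, hcsub.trans ?_⟩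
  rintro _ ⟨t, ht, rfl⟩
  obtain ⟨u, -, hu⟩ := hsub (mem_image_of_mem g (hab' ht))
  exact show g t ∈ logLift K A from hu ▸ hp _

theorem exists_joinedIn_logLift {K : Set ℂ} {A x y z : ℂ} (h : JoinedIn (K \ {A}) x y)
    (hz : A + Complex.exp z = x) : ∃ w, JoinedIn (logLift K A) z w ∧ A + Complex.exp w = y := by
  obtain ⟨γ, hγ⟩ := h
  have hγ' : ∀ t, γ.extend t ∈ K \ {A} := fun t => hγ _
  obtain ⟨f, hf, rfl, hfexp⟩ := exists_continuous_log (g := fun t => γ.extend t - A) (by fun_prop)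
    (fun t => sub_ne_zero.2 (hγ' t).2) (x₀ := 0) (e₀ := z) (by simp [← hz])
  have hA : ∀ t, A + Complex.exp (f t) = γ.extend t := fun t => by rw [hfexp, add_sub_cancel]
  refine ⟨f 1, JoinedIn.ofLine hf.continuousOn rfl rfl ?_, by rw [hA, γ.extend_one]⟩
  rintro _ ⟨t, -, rfl⟩
  exact show _ ∈ K from (hA t).symm ▸ (hγ' t).1

/-! ### Multipliers of words and logarithmic lifts -/

section Words

variable {m : ℕ} (S : Fin m → ContractingSimilarity)

/-- The multiplier of the similarity `S_w`. -/
noncomputable def wordMult (w : List (Fin m)) : ℂ := (w.map fun k => (S k).mult).prod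

@[simp] theorem wordMult_nil : wordMult S [] = 1 := rfl

@[simp] theorem wordMult_cons (k : Fin m) (w : List (Fin m)) :
    wordMult S (k :: w) = (S k).mult * wordMult S w := by
  simp [wordMult]

theorem wordMult_ne_zero (w : List (Fin m)) : wordMult S w ≠ 0 := by
  induction w with
  | nil => simp
  | cons k w ih => simpa using ⟨(S k).mult_ne_zero, ih⟩

theorem norm_wordMult_lt_one {w : List (Fin m)} (hw : w ≠ []) : ‖wordMult S w‖ < 1 := by
  induction w with
  | nil => exact absurd rfl hw
  | cons k w ih =>
    rw [wordMult_cons, norm_mul]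
    rcases eq_or_ne w [] with rfl | hw'
    · simpa using (S k).norm_mult_lt_one
    · exact mul_lt_one_of_nonneg_of_lt_one_left (norm_nonneg _) (S k).norm_mult_lt_one (ih hw').le

theorem wordMap_sub (w : List (Fin m)) (z z' : ℂ) :
    wordMap S w z - wordMap S w z' = wordMult S w * (z - z') := by
  induction w with
  | nil => simp [wordMap]
  | cons k w ih =>
    simp only [wordMap, ContractingSimilarity.toFun, wordMult_cons]
    linear_combination (S k).mult * ih

theorem wordMap_add (w : List (Fin m)) (A z : ℂ) :
    wordMap S w (A + z) = wordMap S w A + wordMult S w * z := by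
  rw [← sub_eq_iff_eq_add', wordMap_sub, add_sub_cancel_left]

theorem continuous_wordMap (w : List (Fin m)) : Continuous (wordMap S w) := by
  have h : wordMap S w = fun z => wordMap S w 0 + wordMult S w * z :=
    funext fun z => by rw [← wordMap_add, zero_add]
  rw [h]
  fun_prop

theorem wordMap_append (u w : List (Fin m)) (z : ℂ) :
    wordMap S (u ++ w) z = wordMap S u (wordMap S w z) := by
  induction u with
  | nil => rfl
  | cons k u ih => simp only [List.cons_append, wordMap, ih]

theorem wordMap_flatten_replicate (w : List (Fin m)) (n : ℕ) :
    wordMap S (List.replicate n w).flatten = (wordMap S w)^[n] := by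
  induction n with
  | zero => rfl
  | succ n ih =>
    funext z
    rw [List.replicate_succ, List.flatten_cons, wordMap_append, ih, Function.iterate_succ_apply']

variable {S}

theorem IsAttractor.wordMap_mem {K : Set ℂ} (hK : IsAttractor S K) (w : List (Fin m)) {z : ℂ}
    (hz : z ∈ K) : wordMap S w z ∈ K := by
  induction w with
  | nil => exact hz
  | cons k w ih =>
    rw [hK.2.2]
    exact mem_iUnion.2 ⟨k, _, ih, rfl⟩

theorem iterate_wordMap_sub {w : List (Fin m)} {A : ℂ} (hA : wordMap S w A = A) (n : ℕ) (z : ℂ) :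
    (wordMap S w)^[n] z - A = wordMult S w ^ n * (z - A) := by
  induction n with
  | zero => simp
  | succ n ih =>
    rw [Function.iterate_succ_apply', ← hA, wordMap_sub, hA, ih, pow_succ', mul_assoc]

theorem IsAttractor.mem_of_wordMap_eq {K : Set ℂ} (hK : IsAttractor S K) {w : List (Fin m)}
    (hw : w ≠ []) {A : ℂ} (hA : wordMap S w A = A) : A ∈ K := by
  obtain ⟨z, hz⟩ := hK.1
  have hlim : Filter.Tendsto (fun n => wordMult S w ^ n * (z - A) + A) Filter.atTop
      (nhds (0 * (z - A) + A)) :=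
    ((tendsto_pow_atTop_nhds_zero_of_norm_lt_one (norm_wordMult_lt_one S hw)).mul_const
      _).add_const _
  rw [zero_mul, zero_add] at hlim
  refine hK.2.1.isClosed.mem_of_tendsto hlim (Filter.Eventually.of_forall fun n => ?_)
  rw [← iterate_wordMap_sub hA, sub_add_cancel, ← wordMap_flatten_replicate]
  exact hK.wordMap_mem _ hz

theorem IsParameter.exists_joinedIn_logLift {K : Set ℂ} {A : ℂ} {lam : ℝ}
    (h : IsParameter S K A lam) : ∃ w v z, w ≠ [] ∧ wordMap S w A = A ∧
      Complex.exp v = wordMult S w ∧ JoinedIn (logLift K A) z (z + v) ∧ lam = v.im / v.re := by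
  obtain ⟨w, r, α, hw, hr, hS, ⟨x, γ, θ, hγ, hθ, hmem, harg, rfl, hγ₁, rfl⟩, rfl⟩ := h
  have hA : wordMap S w A = A := by simp [hS]
  set v : ℂ := Real.log r + (θ 1 - θ 0 : ℝ) * Complex.I with hv
  have hexp : Complex.exp v = r * Complex.exp ((θ 1 - θ 0 : ℝ) * Complex.I) := by
    rw [Complex.exp_add, ← Complex.ofReal_exp, Real.exp_log hr]
  have hnorm : ∀ t ∈ Icc (0 : ℝ) 1, ‖γ t - A‖ ≠ 0 := fun t ht =>
    norm_ne_zero_iff.2 (sub_ne_zero.2 (hmem t ht).2)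
  set l : ℝ → ℂ := fun t => Real.log ‖γ t - A‖ + θ t * Complex.I with hl
  have hlexp : ∀ t ∈ Icc (0 : ℝ) 1, A + Complex.exp (l t) = γ t := fun t ht => by
    rw [hl, Complex.exp_add, ← Complex.ofReal_exp, Real.exp_log (by positivity [hnorm t ht]),
      ← harg t ht, add_sub_cancel]
  have hlog : Real.log ‖γ 1 - A‖ = Real.log r + Real.log ‖γ 0 - A‖ := by
    rw [← Real.log_mul hr.ne' (hnorm 0 (by simp)), hγ₁, hS]
    simp [Complex.norm_exp, abs_of_pos hr]
  refine ⟨w, v, l 0, hw, hA, ?_, JoinedIn.ofLine (f := l) ?_ rfl ?_ ?_, by simp [hv]⟩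
  · have := wordMap_add S w A 1
    rw [hA, hS, ← hexp] at this
    linear_combination this
  · have : ContinuousOn (fun t => Real.log ‖γ t - A‖) (Icc 0 1) :=
      ContinuousOn.log (by fun_prop) hnorm
    fun_prop
  · simp only [hl, hv, hlog]
    push_cast
    ring
  · rintro _ ⟨t, ht, rfl⟩
    exact show _ ∈ K from (hlexp t ht).symm ▸ (hmem t ht).1

theorem isParameter_of_joinedIn_logLift {K : Set ℂ} {A v z : ℂ} {w : List (Fin m)} (hw : w ≠ [])
    (hA : wordMap S w A = A) (hv : Complex.exp v = wordMult S w)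
    (h : JoinedIn (logLift K A) z (z + v)) : IsParameter S K A (v.im / v.re) := by
  obtain ⟨p, hp⟩ := h
  have hS : ∀ x, wordMap S w x = Complex.exp v * (x - A) + A := fun x => by
    rw [hv, ← wordMap_sub, hA, sub_add_cancel]
  have hpolar : ∀ u : ℂ, Complex.exp u =
      ‖Complex.exp u‖ * Complex.exp ((u.im : ℂ) * Complex.I) := fun u => by
    rw [Complex.norm_exp, Complex.ofReal_exp, ← Complex.exp_add, Complex.re_add_im]
  refine ⟨w, Real.exp v.re, v.im, hw, Real.exp_pos _, fun x => ?_,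
    ⟨A + Complex.exp z, fun t => A + Complex.exp (p.extend t), fun t => (p.extend t).im,
      by fun_prop, by fun_prop, fun t _ => ⟨hp _, by simp⟩, fun t _ => ?_, by simp, ?_, by simp⟩,
    by rw [Real.log_exp]⟩
  · rw [← Complex.norm_exp, ← hpolar, hS]
  · simpa using hpolar (p.extend t)
  · simp only [Path.extend_one, hS, Complex.exp_add]
    ring

end Words

/-! ### Spirals -/

/-- `K` contains a curve spiralling towards `B`, with average rate `v.im / v.re`: the logarithm
`t * v + p t` of the curve stays at a bounded distance from the ray `t * v`. -/
def HasSpiral (K : Set ℂ) (B v : ℂ) : Prop :=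
  ∃ (p : ℝ → ℂ) (R : ℝ), Continuous p ∧ (∀ t, ‖p t‖ ≤ R) ∧
    ∀ t : ℝ, 0 ≤ t → t * v + p t ∈ logLift K B

theorem hasSpiral_of_joinedIn_logLift {K : Set ℂ} {A v z : ℂ}
    (h : JoinedIn (logLift K A) z (z + v)) (hv : ∀ u ∈ logLift K A, u + v ∈ logLift K A) :
    HasSpiral K A v := by
  obtain ⟨γ, hγ⟩ := h
  set q : ℝ → ℂ := fun t => γ.extend t - t * v with hq
  have hqc : ContinuousOn q (Icc 0 1) := by fun_prop
  have hq₀₁ : q 0 = q 1 := by simp [hq]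
  obtain ⟨R, hR⟩ := isCompact_Icc.exists_bound_of_continuousOn hqc
  have hfract : ∀ t : ℝ, Int.fract t ∈ Icc (0 : ℝ) 1 := fun t =>
    ⟨Int.fract_nonneg t, (Int.fract_lt_one t).le⟩
  refine ⟨fun t => q (Int.fract t), R, hqc.comp_fract'' hq₀₁, fun t => hR _ (hfract t),
    fun t ht => ?_⟩
  have hiter : ∀ (n : ℕ), ∀ u ∈ logLift K A, u + n * v ∈ logLift K A := fun n u hu => by
    induction n with
    | zero => simpa using hu
    | succ n ih =>
      have := hv _ ih
      rwa [add_assoc, ← add_one_mul, ← Nat.cast_succ] at this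
  have ht' : (t : ℂ) = ⌊t⌋₊ + Int.fract t := by
    rw [← Complex.ofReal_natCast, natCast_floor_eq_intCast_floor ht, ← Complex.ofReal_add,
      Int.floor_add_fract]
  have hsum : t * v + q (Int.fract t) = γ.extend (Int.fract t) + ⌊t⌋₊ * v := by
    linear_combination v * ht'
  exact hsum ▸ hiter _ _ (hγ _)

theorem HasSpiral.wordMap {m : ℕ} {S : Fin m → ContractingSimilarity} {K : Set ℂ}
    (hK : IsAttractor S K) {A v : ℂ} (h : HasSpiral K A v) (u : List (Fin m)) :
    HasSpiral K (wordMap S u A) v := by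
  obtain ⟨p, R, hp, hR, hmem⟩ := h
  refine ⟨fun t => p t + Complex.log (wordMult S u), R + ‖Complex.log (wordMult S u)‖,
    by fun_prop, fun t => (norm_add_le _ _).trans (by gcongr; exact hR t), fun t ht => ?_⟩
  have := hK.wordMap_mem u (hmem t ht)
  rwa [wordMap_add, ← Complex.exp_log (wordMult_ne_zero S u), ← Complex.exp_add, add_comm,
    add_comm (Complex.log _), add_assoc, add_comm] at this

theorem exists_ray_coordinates {v₁ v₂ : ℂ} (hv₁ : v₁.re < 0) (hv₂ : v₂.re < 0)
    (h : v₁.im * v₂.re < v₂.im * v₁.re) :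
    ∃ Φ Ψ : ℂ →L[ℝ] ℝ, (∀ z, Φ z * v₁ - Ψ z * v₂ = z) ∧ 0 < Φ Complex.I ∧ 0 < Ψ Complex.I := by
  set D : ℝ := v₁.im * v₂.re - v₂.im * v₁.re with hD
  have hD₀ : D < 0 := sub_neg.2 h
  have hDinv : D⁻¹ * D = 1 := inv_mul_cancel₀ hD₀.ne
  refine ⟨D⁻¹ • (v₂.re • Complex.imCLM - v₂.im • Complex.reCLM),
    D⁻¹ • (v₁.re • Complex.imCLM - v₁.im • Complex.reCLM), fun z => ?_, ?_, ?_⟩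
  · apply Complex.ext
    · simp
      linear_combination z.re * hDinv + D⁻¹ * z.re * hD
    · simp
      linear_combination z.im * hDinv + D⁻¹ * z.im * hD
  · simpa using mul_pos_of_neg_of_neg (inv_lt_zero.2 hD₀) hv₂
  · simpa using mul_pos_of_neg_of_neg (inv_lt_zero.2 hD₀) hv₁

theorem exists_crossing {v₁ v₂ : ℂ} {p₁ p₂ : ℝ → ℂ} (hp₁ : Continuous p₁) (hp₂ : Continuous p₂)
    {R₁ R₂ : ℝ} (hR₁ : ∀ t, ‖p₁ t‖ ≤ R₁) (hR₂ : ∀ t, ‖p₂ t‖ ≤ R₂) (hv₁ : v₁.re < 0)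
    (hv₂ : v₂.re < 0) (h : v₁.im * v₂.re < v₂.im * v₁.re) :
    ∀ᶠ y : ℝ in Filter.atTop, ∃ s t : ℝ, 0 ≤ s ∧ 0 ≤ t ∧
      s * v₁ + p₁ s = t * v₂ + p₂ t + y * Complex.I := by
  obtain ⟨Φ, Ψ, hΦΨ, hΦ, hΨ⟩ := exists_ray_coordinates hv₁ hv₂ h
  filter_upwards [Filter.eventually_ge_atTop (‖Φ‖ * (R₁ + R₂) / Φ Complex.I),
    Filter.eventually_ge_atTop (‖Ψ‖ * (R₁ + R₂) / Ψ Complex.I)] with y hyΦ hyΨ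
  set d : ℂ → ℂ := fun z => p₂ (Ψ z) - p₁ (Φ z)
  have hdR : ∀ z, ‖d z‖ ≤ R₁ + R₂ := fun z =>
    (norm_sub_le _ _).trans (by linarith [hR₁ (Φ z), hR₂ (Ψ z)])
  obtain ⟨z, hz⟩ := exists_eq_of_bounded (b := fun z => d z + y * Complex.I)
    (R := R₁ + R₂ + ‖y * Complex.I‖) (by fun_prop)
    fun z => (norm_add_le _ _).trans (by gcongr; exact hdR z)
  have hnonneg : ∀ Θ : ℂ →L[ℝ] ℝ, 0 < Θ Complex.I → ‖Θ‖ * (R₁ + R₂) / Θ Complex.I ≤ y →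
      0 ≤ Θ z := fun Θ hΘ hy => by
    have hΘd : -(‖Θ‖ * (R₁ + R₂)) ≤ Θ (d z) :=
      (abs_le.1 ((Θ.le_opNorm _).trans (by gcongr; exact hdR z))).1
    rw [← hz, map_add, ← Complex.real_smul, map_smul, smul_eq_mul]
    linarith [(div_le_iff₀ hΘ).1 hy]
  refine ⟨Φ z, Ψ z, hnonneg Φ hΦ hyΦ, hnonneg Ψ hΨ hyΨ, ?_⟩
  linear_combination hΦΨ z - hz

theorem joinedIn_logLift_of_ray {K : Set ℂ} {B v c : ℂ} {p : ℝ → ℂ} (hp : Continuous p)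
    (hmem : ∀ t : ℝ, 0 ≤ t → t * v + p t ∈ logLift K B) (hc : Complex.exp c = 1) {s t : ℝ}
    (hs : 0 ≤ s) (ht : 0 ≤ t) :
    JoinedIn (logLift K B) (s * v + p s + c) (t * v + p t + c) := by
  have hconn : IsPathConnected ((fun r : ℝ => r * v + p r + c) '' Ici 0) :=
    ((convex_Ici 0).isPathConnected ⟨0, le_rfl⟩).image (by fun_prop)
  refine (hconn.joinedIn _ (mem_image_of_mem _ hs) _ (mem_image_of_mem _ ht)).mono ?_
  rintro _ ⟨r, hr, rfl⟩
  rw [logLift, mem_ofPred_eq, Complex.exp_add, hc, mul_one]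
  exact hmem r hr

-- The two spirals cross on two neighbouring sheets of the logarithm. Following one of them from
-- the first crossing to the second and the other one back turns exactly once around `B`.
theorem HasSpiral.slope_le {K : Set ℂ}
    (hK : ¬∃ c : Circle → ℂ, Continuous c ∧ Function.Injective c ∧ range c ⊆ K) {B v₁ v₂ : ℂ}
    (h₁ : HasSpiral K B v₁) (h₂ : HasSpiral K B v₂) (hv₁ : v₁.re < 0) (hv₂ : v₂.re < 0) :
    v₁.im / v₁.re ≤ v₂.im / v₂.re := by
  obtain ⟨p₁, R₁, hp₁, hR₁, hmem₁⟩ := h₁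
  obtain ⟨p₂, R₂, hp₂, hR₂, hmem₂⟩ := h₂
  by_contra! hlt
  have hslope : v₂.im * v₁.re < v₁.im * v₂.re := by
    rw [← neg_div_neg_eq v₂.im, ← neg_div_neg_eq v₁.im,
      div_lt_div_iff₀ (neg_pos.2 hv₂) (neg_pos.2 hv₁)] at hlt
    linarith
  have hsheets : Filter.Tendsto (fun n : ℕ => (n : ℝ) * (2 * Real.pi)) Filter.atTop Filter.atTop :=
    tendsto_natCast_atTop_atTop.atTop_mul_const Real.two_pi_pos
  obtain ⟨N, hN⟩ := Filter.eventually_atTop.1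
    (hsheets.eventually (exists_crossing hp₂ hp₁ hR₂ hR₁ hv₂ hv₁ hslope))
  obtain ⟨s, t, hs, ht, hst⟩ := hN N le_rfl
  obtain ⟨s', t', hs', ht', hst'⟩ := hN (N + 1) (Nat.le_succ N)
  set c : ℂ := N * (2 * Real.pi * Complex.I) with hc
  have hexp : Complex.exp c = 1 := Complex.exp_nat_mul_two_pi_mul_I N
  have hst : s * v₂ + p₂ s + 0 = t * v₁ + p₁ t + c := by
    rw [add_zero, hst, hc]
    push_cast
    ring
  have hst' : s' * v₂ + p₂ s' + 0 = t' * v₁ + p₁ t' + c + 2 * Real.pi * Complex.I := by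
    rw [add_zero, hst', hc]
    push_cast
    ring
  have hjoin := joinedIn_logLift_of_ray hp₂ hmem₂ Complex.exp_zero hs' hs
  rw [hst, hst'] at hjoin
  refine hK (exists_circle_of_joinedIn_logLift
    (hjoin.trans (joinedIn_logLift_of_ray hp₁ hmem₁ hexp ht ht')) ?_ ?_)
  · exact Complex.exp_periodic _
  · simp

theorem HasSpiral.slope_eq {K : Set ℂ}
    (hK : ¬∃ c : Circle → ℂ, Continuous c ∧ Function.Injective c ∧ range c ⊆ K) {B v₁ v₂ : ℂ}
    (h₁ : HasSpiral K B v₁) (h₂ : HasSpiral K B v₂) (hv₁ : v₁.re < 0) (hv₂ : v₂.re < 0) :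
    v₁.im / v₁.re = v₂.im / v₂.re :=
  le_antisymm (h₁.slope_le hK h₂ hv₁ hv₂) (h₂.slope_le hK h₁ hv₂ hv₁)

theorem IsParameter.exists_hasSpiral {m : ℕ} {S : Fin m → ContractingSimilarity} {K : Set ℂ}
    (hK : IsAttractor S K) {A : ℂ} {lam : ℝ} (h : IsParameter S K A lam) (u : List (Fin m)) :
    ∃ v, v.re < 0 ∧ lam = v.im / v.re ∧ HasSpiral K (PolygonalSystem.wordMap S u A) v := by
  obtain ⟨w, v, z, hw, hA, hv, hjoin, rfl⟩ := h.exists_joinedIn_logLift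
  refine ⟨v, ?_, rfl, (hasSpiral_of_joinedIn_logLift hjoin fun x hx => ?_).wordMap hK u⟩
  · rw [← Real.exp_lt_one_iff, ← Complex.norm_exp, hv]
    exact norm_wordMult_lt_one S hw
  · have := hK.wordMap_mem w hx
    rwa [wordMap_add, hA, ← hv, ← Complex.exp_add, add_comm v] at this

theorem IsParameter.eq_of_wordMap_eq {m : ℕ} {S : Fin m → ContractingSimilarity} {K : Set ℂ}
    (hK : IsAttractor S K)
    (hcirc : ¬∃ c : Circle → ℂ, Continuous c ∧ Function.Injective c ∧ range c ⊆ K)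
    {A A' : ℂ} {lam lam' : ℝ} (h : IsParameter S K A lam) (h' : IsParameter S K A' lam')
    {u u' : List (Fin m)} (huu' : wordMap S u A = wordMap S u' A') : lam = lam' := by
  obtain ⟨v, hv, rfl, hs⟩ := h.exists_hasSpiral hK u
  obtain ⟨v', hv', rfl, hs'⟩ := h'.exists_hasSpiral hK u'
  exact hs.slope_eq hcirc (huu' ▸ hs') hv hv'

/-! ### Paths in connected attractors -/

section PathConnected

variable {ι X : Type*} [TopologicalSpace X] {S : ι → X → X} {K : Set X} {x y z : X}

/-- Every family of paths `Φ a b` between the points of the space can be turned into a path from `x`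
to `y` which is composed of paths `S k ∘ Φ a b` with `a b ∈ K`. The pieces that are used do not
depend on the family. -/
def IsRefinable (S : ι → X → X) (K : Set X) (x y : X) : Prop :=
  ∃ T : (∀ a b : X, Path a b) → Path x y,
    ∀ t, ∃ k, ∃ a ∈ K, ∃ b ∈ K, ∃ s, ∀ Φ, T Φ t = S k (Φ a b s)

theorem isRefinable_map {k : ι} (hS : Continuous (S k)) (hx : x ∈ K) (hy : y ∈ K) :
    IsRefinable S K (S k x) (S k y) :=
  ⟨fun Φ => (Φ x y).map hS, fun t => ⟨k, x, hx, y, hy, t, fun _ => rfl⟩⟩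

theorem IsRefinable.trans (h : IsRefinable S K x y) (h' : IsRefinable S K y z) :
    IsRefinable S K x z := by
  obtain ⟨T, hT⟩ := h
  obtain ⟨T', hT'⟩ := h'
  refine ⟨fun Φ => (T Φ).trans (T' Φ), fun t => ?_⟩
  simp only [Path.trans_apply]
  split_ifs
  · exact hT _
  · exact hT' _

theorem isRefinable_of_isPreconnected [Finite ι] [T2Space X] (hS : ∀ k, Continuous (S k))
    (hK : IsCompact K) (hKS : K = ⋃ k, S k '' K) (hc : IsPreconnected K) (hx : x ∈ K)
    (hy : y ∈ K) : IsRefinable S K x y := by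
  by_contra hxy
  set J : Set ι := {k | ∃ a ∈ K, IsRefinable S K x (S k a)}
  have hreach : ∀ k ∈ J, ∀ b ∈ K, IsRefinable S K x (S k b) := fun k ⟨_, ha, h⟩ _ hb =>
    h.trans (isRefinable_map (hS k) ha hb)
  have hclosed : ∀ I : Set ι, IsClosed (⋃ k ∈ I, S k '' K) := fun I =>
    (toFinite I).isClosed_biUnion fun k _ => (hK.image (hS k)).isClosed
  have hpre : ∀ z ∈ K, ∃ k, ∃ a ∈ K, S k a = z := fun z hz => mem_iUnion.1 (hKS ▸ hz)
  obtain ⟨k₀, x, hx', rfl⟩ := hpre x hx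
  obtain ⟨k₁, y, hy', rfl⟩ := hpre y hy
  obtain ⟨z, -, hz, hz'⟩ := isPreconnected_closed_iff.1 hc _ _ (hclosed J) (hclosed Jᶜ)
    (fun z hz => by
      rw [← biUnion_union, union_compl_self, biUnion_univ, ← hKS]
      exact hz)
    ⟨_, hx, mem_biUnion (show k₀ ∈ J from ⟨x, hx', isRefinable_map (hS k₀) hx' hx'⟩)
      (mem_image_of_mem _ hx')⟩
    ⟨_, hy, mem_biUnion (show k₁ ∈ Jᶜ from fun h => hxy (hreach k₁ h y hy'))
      (mem_image_of_mem _ hy')⟩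
  obtain ⟨k, hk, a, ha, rfl⟩ := mem_iUnion₂.1 hz
  obtain ⟨k', hk', b, hb, h⟩ := mem_iUnion₂.1 hz'
  exact hk' ⟨b, hb, h ▸ hreach k hk a ha⟩

theorem iterate_refinement_induction {T : (∀ a b : X, Path a b) → ∀ a b : X, Path a b}
    (hT : ∀ x ∈ K, ∀ y ∈ K, ∀ t, ∃ k, ∃ a ∈ K, ∃ b ∈ K, ∃ s, ∀ Φ, T Φ x y t = S k (Φ a b s))
    {Φ Ψ : ∀ a b : X, Path a b} {R : ℕ → X → X → Prop}
    (h₀ : ∀ x ∈ K, ∀ y ∈ K, ∀ t, R 0 (Φ x y t) (Ψ x y t))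
    (hS : ∀ n k u v, R n u v → R (n + 1) (S k u) (S k v)) (n : ℕ) :
    ∀ x ∈ K, ∀ y ∈ K, ∀ t, R n (T^[n] Φ x y t) (T^[n] Ψ x y t) := by
  induction n with
  | zero => exact h₀
  | succ n ih =>
    intro x hx y hy t
    obtain ⟨k, a, ha, b, hb, s, h⟩ := hT x hx y hy t
    rw [Function.iterate_succ_apply', Function.iterate_succ_apply', h, h]
    exact hS n k _ _ (ih a ha b hb s)

end PathConnected

theorem infDist_le_mul_infDist {ι X : Type*} [PseudoMetricSpace X] {S : ι → X → X} {K : Set X}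
    {r : NNReal} {k : ι} (hS : LipschitzWith r (S k)) (hne : K.Nonempty) (hK : IsCompact K)
    (hKS : K = ⋃ k, S k '' K) (u : X) : infDist (S k u) K ≤ r * infDist u K := by
  obtain ⟨z, hz, hzu⟩ := hK.exists_infDist_eq_dist hne u
  rw [hzu]
  refine (infDist_le_dist_of_mem ?_).trans (hS.dist_le_mul u z)
  rw [hKS]
  exact mem_iUnion.2 ⟨k, z, hz, rfl⟩

theorem joinedIn_of_cauchySeq_path {X : Type*} [MetricSpace X] [CompleteSpace X] {K : Set X}
    {x y : X} (hx : x ∈ K) (hK : IsClosed K) {Φ : ℕ → Path x y} {r C : ℝ} (hr₀ : 0 ≤ r)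
    (hr₁ : r < 1) (hcauchy : ∀ n t, dist (Φ n t) (Φ (n + 1) t) ≤ C * r ^ n)
    (hnear : ∀ n t, infDist (Φ n t) K ≤ C * r ^ n) : JoinedIn K x y := by
  have hC : 0 ≤ C := by simpa using dist_nonneg.trans (hcauchy 0 0)
  set F : ℕ → C(unitInterval, X) := fun n => (Φ n : C(unitInterval, X))
  have hF : CauchySeq F := cauchySeq_of_le_geometric r C hr₁ fun n =>
    (ContinuousMap.dist_le (by positivity)).2 (hcauchy n)
  obtain ⟨G, hG⟩ := cauchySeq_tendsto_of_complete hF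
  have hGt : ∀ t, Filter.Tendsto (fun n => Φ n t) Filter.atTop (nhds (G t)) := fun t =>
    ((continuous_eval_const t).tendsto G).comp hG
  refine ⟨⟨G, tendsto_nhds_unique (hGt 0) (by simp), tendsto_nhds_unique (hGt 1) (by simp)⟩,
    fun t => (hK.mem_iff_infDist_zero ⟨x, hx⟩).2 (le_antisymm ?_ infDist_nonneg)⟩
  refine le_of_tendsto_of_tendsto' (((continuous_infDist_pt K).tendsto _).comp (hGt t)) ?_
    fun n => hnear n t
  simpa using (tendsto_pow_atTop_nhds_zero_of_lt_one hr₀ hr₁).const_mul C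

theorem exists_refinement {ι X : Type*} [TopologicalSpace X] [T2Space X] [Finite ι]
    {S : ι → X → X} {K : Set X} (hS : ∀ k, Continuous (S k)) (hK : IsCompact K)
    (hKS : K = ⋃ k, S k '' K) (hc : IsPreconnected K) :
    ∃ T : (∀ a b : X, Path a b) → ∀ a b : X, Path a b, ∀ x ∈ K, ∀ y ∈ K, ∀ t,
      ∃ k, ∃ a ∈ K, ∃ b ∈ K, ∃ s, ∀ Φ, T Φ x y t = S k (Φ a b s) := by
  have h : ∀ x y, ∃ T : (∀ a b : X, Path a b) → Path x y, x ∈ K → y ∈ K →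
      ∀ t, ∃ k, ∃ a ∈ K, ∃ b ∈ K, ∃ s, ∀ Φ, T Φ t = S k (Φ a b s) := fun x y => by
    by_cases hxy : x ∈ K ∧ y ∈ K
    · obtain ⟨T, hT⟩ := isRefinable_of_isPreconnected hS hK hKS hc hxy.1 hxy.2
      exact ⟨T, fun _ _ => hT⟩
    · exact ⟨fun Φ => Φ x y, fun hx hy => absurd ⟨hx, hy⟩ hxy⟩
  choose T hT using h
  exact ⟨fun Φ x y => T x y Φ, fun x hx y hy => hT x y hx hy⟩

-- Refining the segments between the points of `K` again and again gives, between any two of them,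
-- a Cauchy sequence of paths that approach `K`.
theorem joinedIn_of_eq_iUnion_image {ι E : Type*} [Finite ι] [NormedAddCommGroup E]
    [NormedSpace ℝ E] [CompleteSpace E] {S : ι → E → E} {K : Set E} {r : NNReal} (hr : r < 1)
    (hS : ∀ k, LipschitzWith r (S k)) (hK : IsCompact K) (hKS : K = ⋃ k, S k '' K)
    (hc : IsPreconnected K) {x y : E} (hx : x ∈ K) (hy : y ∈ K) : JoinedIn K x y := by
  obtain ⟨T, hT⟩ := exists_refinement (fun k => (hS k).continuous) hK hKS hc
  set H : Set E := convexHull ℝ K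
  have hKH : K ⊆ H := subset_convexHull ℝ K
  set H' : Set E := H ∪ ⋃ k, S k '' H
  have hH : Bornology.IsBounded H := isBounded_convexHull.2 hK.isBounded
  have hH' : Bornology.IsBounded H' :=
    hH.union (Bornology.isBounded_iUnion.2 fun k => (hS k).isBounded_image hH)
  have hsegment : ∀ a ∈ K, ∀ b ∈ K, ∀ t, Path.segment a b t ∈ H := fun a ha b hb t =>
    (convex_convexHull ℝ K).lineMap_mem (hKH ha) (hKH hb) t.2
  refine joinedIn_of_cauchySeq_path (Φ := fun n => T^[n] Path.segment x y) (r := r) (C := diam H')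
    hx hK.isClosed r.2 hr (fun n => ?_) (fun n => ?_)
  · rw [Function.iterate_succ_apply]
    refine iterate_refinement_induction hT (R := fun n u v => dist u v ≤ diam H' * r ^ n)
      (fun a ha b hb t => ?_) (fun n k u v h => ?_) n x hx y hy
    · obtain ⟨k, a', ha', b', hb', s, h⟩ := hT a ha b hb t
      rw [pow_zero, mul_one, h]
      exact dist_le_diam_of_mem hH' (Or.inl (hsegment a ha b hb t))
        (Or.inr (mem_iUnion.2 ⟨k, _, hsegment a' ha' b' hb' s, rfl⟩))
    · calc dist (S k u) (S k v) ≤ r * (diam H' * r ^ n) :=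
            ((hS k).dist_le_mul u v).trans (by gcongr)
        _ = diam H' * r ^ (n + 1) := by ring
  · refine iterate_refinement_induction hT (R := fun n u _ => infDist u K ≤ diam H' * r ^ n)
      (Ψ := Path.segment) (fun a ha b hb t => ?_) (fun n k u _ h => ?_) n x hx y hy
    · rw [pow_zero, mul_one]
      exact (infDist_le_dist_of_mem ha).trans
        (dist_le_diam_of_mem hH' (Or.inl (hsegment a ha b hb t)) (Or.inl (hKH ha)))
    · calc infDist (S k u) K ≤ r * (diam H' * r ^ n) :=
            (infDist_le_mul_infDist (hS k) ⟨x, hx⟩ hK hKS u).trans (by gcongr)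
        _ = diam H' * r ^ (n + 1) := by ring

theorem ContractingSimilarity.lipschitzWith (s : ContractingSimilarity) :
    LipschitzWith ‖s.mult‖₊ s :=
  LipschitzWith.of_dist_le_mul fun z z' => by
    simp [dist_eq_norm, ContractingSimilarity.toFun, ← mul_sub]

theorem IsAttractor.joinedIn {m : ℕ} {S : Fin m → ContractingSimilarity} {K : Set ℂ}
    (hK : IsAttractor S K) (hc : IsConnected K) {x y : ℂ} (hx : x ∈ K) (hy : y ∈ K) :
    JoinedIn K x y := by
  refine joinedIn_of_eq_iUnion_image (r := Finset.univ.sup fun k => ‖(S k).mult‖₊) ?_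
    (fun k => (S k).lipschitzWith.weaken ?_) hK.2.1 hK.2.2 hc.isPreconnected hx hy
  · exact (Finset.sup_lt_iff (by simp)).2 fun k _ => (S k).norm_mult_lt_one
  · exact Finset.le_sup (f := fun k => ‖(S k).mult‖₊) (Finset.mem_univ k)

/-! ### Triods and their perturbations -/

theorem log_sub_log_eq_of_forall_ne {α β κ ℓ m l l' : ℝ → ℂ} (hα : Continuous α)
    (hβ : Continuous β) (hκ : Continuous κ) (hne : ∀ s t, α s ≠ κ t)
    (h : ∀ s, ‖κ 0 - β 0‖ < ‖α s - β 0‖) (h' : ∀ t, ‖κ t - β t‖ < ‖α 0 - β t‖)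
    (hℓ : Continuous ℓ) (hℓexp : ∀ t, Complex.exp (ℓ t) = α 1 - κ t)
    (hm : Continuous m) (hmexp : ∀ s, Complex.exp (m s) = α s - κ 1) (hℓm : ℓ 1 = m 1)
    (hl : Continuous l) (hlexp : ∀ s, Complex.exp (l s) = α s - β 0)
    (hl' : Continuous l') (hlexp' : ∀ t, Complex.exp (l' t) = β t - α 0) :
    ℓ 0 - m 0 = (l 1 - l 0) - (l' 1 - l' 0) +
      (Complex.log ((α 1 - κ 0) / (α 1 - β 0)) - Complex.log ((α 0 - κ 1) / (α 0 - β 1))) := by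
  obtain ⟨L, hL, hL₁, hLexp⟩ := exists_continuous_log (g := fun q : ℝ × ℝ => α q.1 - κ q.2)
    (by fun_prop) (fun q => sub_ne_zero.2 (hne q.1 q.2)) (x₀ := (1, 1)) (hℓexp 1)
  have hLℓ : (fun t => L (1, t)) = ℓ := eq_of_exp_eq (by fun_prop) hℓ
    (fun t => (hLexp _).trans (hℓexp t).symm) hL₁
  have hLm : (fun s => L (s, 1)) = m := eq_of_exp_eq (by fun_prop) hm
    (fun s => (hLexp _).trans (hmexp s).symm) (hL₁.trans hℓm)
  have hαβ : ∀ s, α s - β 0 ≠ 0 := fun s => norm_pos_iff.1 ((norm_nonneg _).trans_lt (h s))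
  have hβα : ∀ t, α 0 - β t ≠ 0 := fun t => norm_pos_iff.1 ((norm_nonneg _).trans_lt (h' t))
  have hincr := sub_eq_sub_add_log_sub_log (f := fun s => L (s, 0)) (g := l)
    (q := fun s => (α s - κ 0) / (α s - β 0)) (by fun_prop) hl
    ((hα.sub continuous_const).div (hα.sub continuous_const) hαβ)
    (fun s => sub_div_sub_mem_slitPlane (h s))
    (fun s => by rw [hLexp, hlexp, div_mul_cancel₀ _ (hαβ s)]) 0 1
  have hincr' := sub_eq_sub_add_log_sub_log (f := fun t => L (0, t))
    (g := fun t => l' t + Real.pi * Complex.I)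
    (q := fun t => (α 0 - κ t) / (α 0 - β t)) (by fun_prop) (by fun_prop)
    ((continuous_const.sub hκ).div (continuous_const.sub hβ) hβα)
    (fun t => sub_div_sub_mem_slitPlane (h' t))
    (fun t => by rw [hLexp, Complex.exp_add, hlexp', Complex.exp_pi_mul_I, mul_neg_one, neg_sub,
      div_mul_cancel₀ _ (hβα t)]) 0 1
  linear_combination hincr - hincr' - congrFun hLℓ 0 + congrFun hLm 0

theorem log_add_log_eq_of_forall_ne {α β κ κ' ℓ ℓ' m m' : ℝ → ℂ} {A B : ℂ} (hα : Continuous α)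
    (hβ : Continuous β) (hκ : Continuous κ) (hκ' : Continuous κ') (hα₁ : α 1 = A) (hβ₁ : β 1 = A)
    (hκ₁ : κ 1 = B) (hκ₁' : κ' 1 = B) (hne : ∀ s t, α s ≠ κ' t) (hne' : ∀ s t, β s ≠ κ t)
    (hcl : ∀ s, ‖κ s - α s‖ < ‖β 0 - α s‖) (hcl₀ : ∀ t, ‖κ 0 - α 0‖ < ‖β t - α 0‖)
    (hcl' : ∀ t, ‖κ' t - β t‖ < ‖α 0 - β t‖) (hcl₀' : ∀ s, ‖κ' 0 - β 0‖ < ‖α s - β 0‖)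
    (hℓ : Continuous ℓ) (hℓexp : ∀ t, Complex.exp (ℓ t) = A - κ t)
    (hℓ' : Continuous ℓ') (hℓexp' : ∀ t, Complex.exp (ℓ' t) = A - κ' t)
    (hm : Continuous m) (hmexp : ∀ s, Complex.exp (m s) = α s - B)
    (hm' : Continuous m') (hmexp' : ∀ s, Complex.exp (m' s) = β s - B)
    (h₁ : ℓ 1 = m' 1) (h₁' : ℓ' 1 = m 1) :
    (ℓ 0 - Complex.log ((A - κ 0) / (A - α 0))) + (ℓ' 0 - Complex.log ((A - κ' 0) / (A - β 0))) =
      (m 0 - Complex.log ((α 0 - B) / (α 0 - A))) +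
        (m' 0 - Complex.log ((β 0 - B) / (β 0 - A))) := by
  subst hα₁ hκ₁
  have hαβ : ∀ s, α s - β 0 ≠ 0 := fun s => norm_pos_iff.1 ((norm_nonneg _).trans_lt (hcl₀' s))
  have hβα : ∀ t, β t - α 0 ≠ 0 := fun t => norm_pos_iff.1 ((norm_nonneg _).trans_lt (hcl₀ t))
  obtain ⟨l, hl, -, hlexp⟩ := exists_continuous_log (g := fun s => α s - β 0) (by fun_prop) hαβ
    (Complex.exp_log (hαβ 0))
  obtain ⟨l', hl', -, hlexp'⟩ := exists_continuous_log (g := fun t => β t - α 0) (by fun_prop) hβα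
    (Complex.exp_log (hβα 0))
  have key := log_sub_log_eq_of_forall_ne hα hβ hκ' hne hcl₀' hcl' hℓ' hℓexp' hm
    (by rwa [hκ₁']) h₁' hl hlexp hl' hlexp'
  have key' := log_sub_log_eq_of_forall_ne hβ hα hκ hne' hcl₀ hcl hℓ (by rwa [hβ₁]) hm' hmexp' h₁
    hl' hlexp' hl hlexp
  rw [hκ₁', hβ₁] at key
  rw [hβ₁] at key'
  linear_combination key + key'

-- If the triod and its perturbation were disjoint, then for any two legs the logarithms of the
-- vectors between `A` and their ends would cancel out up to a sign; with three legs each of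
-- them would cancel by itself, although `A - γ i 0` and `γ i 0 - A` are opposite.
theorem exists_eq_of_triod {γ κ : Fin 3 → ℝ → ℂ} (hγ : ∀ i, Continuous (γ i))
    (hκ : ∀ i, Continuous (κ i)) {A B : ℂ} (hA : ∀ i, γ i 1 = A) (hB : ∀ i, κ i 1 = B)
    (hcl : ∀ i j, i ≠ j → ∀ s, ‖κ i s - γ i s‖ < ‖γ j 0 - γ i s‖)
    (hcl₀ : ∀ i j, i ≠ j → ∀ s, ‖κ i 0 - γ i 0‖ < ‖γ j s - γ i 0‖) :
    ∃ i j s t, γ i s = κ j t := by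
  by_contra! hne
  have hAB : Complex.exp (Complex.log (A - B)) = A - B :=
    Complex.exp_log (sub_ne_zero.2 (hA 0 ▸ hB 0 ▸ hne 0 0 1 1))
  have hℓ : ∀ i, ∃ ℓ : ℝ → ℂ, Continuous ℓ ∧ ℓ 1 = Complex.log (A - B) ∧
      ∀ t, Complex.exp (ℓ t) = A - κ i t := fun i =>
    exists_continuous_log (g := fun t => A - κ i t) (continuous_const.sub (hκ i))
      (fun t => sub_ne_zero.2 (hA i ▸ hne i i 1 t)) (by rw [hAB, hB])
  have hm : ∀ i, ∃ m : ℝ → ℂ, Continuous m ∧ m 1 = Complex.log (A - B) ∧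
      ∀ s, Complex.exp (m s) = γ i s - B := fun i =>
    exists_continuous_log (g := fun s => γ i s - B) ((hγ i).sub continuous_const)
      (fun s => sub_ne_zero.2 (hB i ▸ hne i i s 1)) (by rw [hAB, hA])
  choose ℓ hℓ hℓ₁ hℓexp using hℓ
  choose m hm hm₁ hmexp using hm
  set x : Fin 3 → ℂ := fun i => ℓ i 0 - Complex.log ((A - κ i 0) / (A - γ i 0)) with hx
  set y : Fin 3 → ℂ := fun i => m i 0 - Complex.log ((γ i 0 - B) / (γ i 0 - A)) with hy
  have hxy : ∀ i j, i ≠ j → x i + x j = y i + y j := fun i j hij =>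
    log_add_log_eq_of_forall_ne (hγ i) (hγ j) (hκ i) (hκ j) (hA i) (hA j) (hB i) (hB j)
      (hne i j) (hne j i) (hcl i j hij) (hcl₀ i j hij) (hcl j i hij.symm) (hcl₀ j i hij.symm)
      (hℓ i) (hℓexp i) (hℓ j) (hℓexp j) (hm i) (hmexp i) (hm j) (hmexp j)
      ((hℓ₁ i).trans (hm₁ j).symm) ((hℓ₁ j).trans (hm₁ i).symm)
  have hxy₀ : x 0 = y 0 := by
    linear_combination (hxy 0 1 (by decide) + hxy 0 2 (by decide) - hxy 1 2 (by decide)) / 2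
  have hA₀ : A - γ 0 0 ≠ 0 :=
    norm_pos_iff.1 (hA 1 ▸ (norm_nonneg _).trans_lt (hcl₀ 0 1 (by decide) 1))
  have hκ₀ : A - κ 0 0 ≠ 0 := sub_ne_zero.2 (hA 0 ▸ hne 0 0 1 0)
  have hB₀ : γ 0 0 - B ≠ 0 := sub_ne_zero.2 (hB 0 ▸ hne 0 0 0 1)
  have hA₀' : γ 0 0 - A ≠ 0 := by rwa [← neg_sub, neg_ne_zero]
  have hexp : A - γ 0 0 = γ 0 0 - A := calc
    A - γ 0 0 = Complex.exp (x 0) := by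
      rw [hx, Complex.exp_sub, hℓexp, Complex.exp_log (div_ne_zero hκ₀ hA₀), div_div_cancel₀ hκ₀]
    _ = Complex.exp (y 0) := by rw [hxy₀]
    _ = γ 0 0 - A := by
      rw [hy, Complex.exp_sub, hmexp, Complex.exp_log (div_ne_zero hB₀ hA₀'), div_div_cancel₀ hB₀]
  exact hA₀ (by linear_combination (1 / 2 : ℂ) * hexp)

/-! ### Components of the complement of a point -/

theorem exists_path_joinedIn_diff {X : Type*} [TopologicalSpace X] [T1Space X] {K : Set X}
    {x A : X} (h : JoinedIn K x A) (hne : x ≠ A) :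
    ∃ γ : Path x A, (∀ t, γ t ∈ K) ∧ ∀ t, γ t ≠ A → JoinedIn (K \ {A}) x (γ t) := by
  obtain ⟨p, hp⟩ := h
  obtain ⟨t₀, ht₀ : p t₀ = A, hmin⟩ := (isClosed_singleton.preimage p.continuous).isCompact
    |>.exists_isLeast ⟨1, p.target⟩
  have hpos : 0 < t₀ := unitInterval.pos_iff_ne_zero.2 fun h => hne (by rw [← ht₀, h, p.source])
  let γ : Path x A := ⟨⟨fun t => p (t₀ * t), by fun_prop⟩, by simp, by simp [ht₀]⟩
  refine ⟨γ, fun t => hp _, fun t ht => ⟨⟨⟨fun s => γ (t * s), by fun_prop⟩, by simp, by simp⟩,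
    fun s => ⟨hp _, fun hs : p (t₀ * (t * s)) = A => ?_⟩⟩⟩
  have ht₁ : t ≠ 1 := fun h => ht (h ▸ γ.target)
  have h₁ : (t₀ : ℝ) ≤ t₀ * (t * s) := hmin hs
  have h₂ : (t : ℝ) < 1 := unitInterval.lt_one_iff_ne_one.2 ht₁
  have h₃ : (0 : ℝ) < t₀ := hpos
  nlinarith [mul_le_of_le_one_right t.2.1 s.2.2]

theorem exists_forall_norm_sub_lt_imp_exists_mem {K : Set ℂ} {A : ℂ} {x : Fin 3 → ℂ}
    (hxA : ∀ i, x i ≠ A) (hx : ∀ i, JoinedIn K (x i) A)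
    (hno : ∀ i j, i ≠ j → ¬ JoinedIn (K \ {A}) (x i) (x j)) :
    ∃ η > 0, ∀ h : ℂ → ℂ, Continuous h → (∀ z ∈ K, ‖h z - z‖ < η) → ∃ z ∈ K, h z ∈ K := by
  choose γ hγK hγ using fun i => exists_path_joinedIn_diff (hx i) (hxA i)
  have hpos : ∀ i j, i ≠ j → 0 < infDist (x j) (range (γ i)) := fun i j hij => by
    refine ((isCompact_range (γ i).continuous).isClosed.notMem_iff_infDist_pos
      (range_nonempty _)).1 ?_
    rintro ⟨t, ht⟩
    exact hno i j hij (ht ▸ hγ i t (ht ▸ hxA j))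
  have hev : ∀ᶠ η in nhdsWithin (0 : ℝ) (Ioi 0), ∀ i j, i ≠ j → η < infDist (x j) (range (γ i)) :=
    Filter.eventually_all.2 fun i => Filter.eventually_all.2 fun j => Filter.eventually_all.2
      fun hij => (eventually_lt_nhds (hpos i j hij)).filter_mono nhdsWithin_le_nhds
  obtain ⟨η, hη, hη₀⟩ := (hev.and self_mem_nhdsWithin).exists
  have hsep : ∀ i j, i ≠ j → ∀ s, η < ‖x j - (γ i).extend s‖ := fun i j hij s =>
    (hη i j hij).trans_le ((infDist_le_dist_of_mem (mem_range_self _)).trans_eq (dist_eq_norm _ _))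
  refine ⟨η, hη₀, fun h hh hclose => ?_⟩
  obtain ⟨i, j, s, t, hst⟩ := exists_eq_of_triod (γ := fun i s => (γ i).extend s)
    (κ := fun i s => h ((γ i).extend s)) (A := A) (B := h A) (by fun_prop) (by fun_prop)
    (by simp) (by simp)
    (fun i j hij s => (hclose _ (hγK i _)).trans (by simpa using hsep i j hij s))
    (fun i j hij s => (hclose _ (hγK i _)).trans
      (by simpa [norm_sub_rev] using hsep j i hij.symm s))
  exact ⟨_, hγK j _, hst ▸ hγK i _⟩

theorem exists_norm_sub_lt_of_norm_le {E : Type*} [NormedAddCommGroup E] [NormedSpace ℝ E]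
    [ProperSpace E] (C : ℝ) {ε : ℝ} (hε : 0 < ε) : ∃ N : ℕ, ∀ σ > 0, ∀ a : Fin (N + 1) → E,
      (∀ n, ‖a n‖ ≤ C * σ) → ∃ n n', n ≠ n' ∧ ‖a n - a n'‖ < ε * σ := by
  obtain ⟨t, htf, hcov⟩ := totallyBounded_iff.1
    (isCompact_closedBall (0 : E) C).totallyBounded (ε / 2) (by positivity)
  have := htf.fintype
  refine ⟨Fintype.card t, fun σ hσ a ha => ?_⟩
  have hex : ∀ n, ∃ y : t, ‖σ⁻¹ • a n - y‖ < ε / 2 := fun n => by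
    obtain ⟨y, hy, h⟩ := mem_iUnion₂.1 (hcov (mem_closedBall_zero_iff.2
      (show ‖σ⁻¹ • a n‖ ≤ C by
        rw [norm_smul, norm_inv, Real.norm_of_nonneg hσ.le, inv_mul_le_iff₀ hσ, mul_comm]
        exact ha n)))
    exact ⟨⟨y, hy⟩, by rwa [← dist_eq_norm]⟩
  choose y hy using hex
  obtain ⟨n, n', hne, h⟩ := Fintype.exists_ne_map_eq_of_card_lt y (by simp)
  refine ⟨n, n', hne, ?_⟩
  have hlt : ‖σ⁻¹ • (a n - a n')‖ < ε := calc
    ‖σ⁻¹ • (a n - a n')‖ = ‖(σ⁻¹ • a n - y n) - (σ⁻¹ • a n' - y n')‖ := by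
      rw [h, sub_sub_sub_cancel_right, smul_sub]
    _ < ε := (norm_sub_le _ _).trans_lt (by linarith [hy n, hy n'])
  rwa [norm_smul, norm_inv, Real.norm_of_nonneg hσ.le, inv_mul_lt_iff₀ hσ, mul_comm] at hlt

section Components

variable {m : ℕ} {S : Fin m → ContractingSimilarity} {K : Set ℂ} {A : ℂ}

theorem IsAttractor.exists_word (hK : IsAttractor S K) :
    ∃ r₀ > 0, ∀ σ, 0 < σ → σ ≤ 1 → ∀ p ∈ K, ∃ u,
      p ∈ wordMap S u '' K ∧ r₀ * σ ≤ ‖wordMult S u‖ ∧ ‖wordMult S u‖ ≤ σ := by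
  obtain ⟨q, hq⟩ := hK.1
  obtain ⟨k, -⟩ := mem_iUnion.1 (hK.2.2 ▸ hq)
  have : Nonempty (Fin m) := ⟨k⟩
  obtain ⟨k₀, hk₀⟩ := Finite.exists_min fun k => ‖(S k).mult‖
  obtain ⟨k₁, hk₁⟩ := Finite.exists_max fun k => ‖(S k).mult‖
  have hpos : ∀ k, 0 < ‖(S k).mult‖ := fun k => norm_pos_iff.2 (S k).mult_ne_zero
  refine ⟨‖(S k₀).mult‖, hpos k₀, fun σ hσ hσ₁ p hp => ?_⟩
  obtain ⟨n, hn⟩ := exists_pow_lt_of_lt_one hσ (S k₁).norm_mult_lt_one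
  induction n generalizing σ p with
  | zero => exact absurd hn (by simpa using hσ₁)
  | succ n ih =>
    obtain ⟨k, p', hp', rfl⟩ := mem_iUnion.1 (hK.2.2 ▸ hp)
    rcases le_or_gt (‖(S k).mult‖) σ with hk | hk
    · refine ⟨[k], ⟨p', hp', rfl⟩, ?_, by simpa using hk⟩
      simpa using (mul_le_of_le_one_right (hpos k₀).le hσ₁).trans (hk₀ k)
    · have hn' : ‖(S k₁).mult‖ ^ n < σ / ‖(S k).mult‖ := by
        rw [pow_succ] at hn
        exact (lt_div_iff₀ (hpos k)).2
          ((mul_le_mul_of_nonneg_left (hk₁ k) (by positivity)).trans_lt hn)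
      obtain ⟨u, ⟨z, hz, rfl⟩, hle, hge⟩ := ih (σ / ‖(S k).mult‖) (div_pos hσ (hpos k))
        ((div_le_one (hpos k)).2 hk.le) p' hp' hn'
      rw [← mul_div_assoc, div_le_iff₀' (hpos k)] at hle
      rw [le_div_iff₀' (hpos k)] at hge
      exact ⟨k :: u, ⟨z, hz, rfl⟩, by simpa using hle, by simpa using hge⟩

theorem IsAttractor.exists_word_joinedIn (hK : IsAttractor S K) (hc : IsConnected K)
    (hA : A ∈ K) : ∃ r₀ > 0, ∀ x ∈ K, x ≠ A → ∀ σ > 0, 2 * diam K * σ ≤ ‖x - A‖ → ∃ u,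
      r₀ * σ ≤ ‖wordMult S u‖ ∧ ‖wordMult S u‖ ≤ σ ∧ ‖wordMap S u A - A‖ ≤ 3 * diam K * σ ∧
        ∀ z ∈ K, JoinedIn (K \ {A}) x (wordMap S u z) := by
  obtain ⟨r₀, hr₀, hword⟩ := hK.exists_word
  have hdiam : ∀ z ∈ K, ∀ z' ∈ K, ‖z - z'‖ ≤ diam K := fun z hz z' hz' =>
    dist_eq_norm z z' ▸ dist_le_diam_of_mem hK.2.1.isBounded hz hz'
  refine ⟨r₀, hr₀, fun x hx hxA σ hσ hle => ?_⟩
  have hD : 0 < diam K := (norm_pos_iff.2 (sub_ne_zero.2 hxA)).trans_le (hdiam x hx A hA)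
  have hσ₁ : σ ≤ 1 := by nlinarith [hdiam x hx A hA]
  obtain ⟨γ, hγK, hγ⟩ := exists_path_joinedIn_diff (hK.joinedIn hc hx hA) hxA
  obtain ⟨t, ht : ‖γ t - A‖ = 2 * diam K * σ⟩ : 2 * diam K * σ ∈ range fun t => ‖γ t - A‖ :=
    mem_range_of_exists_le_of_exists_ge (by fun_prop) ⟨1, by simpa using by positivity⟩
      ⟨0, by simpa using hle⟩
  obtain ⟨u, ⟨z₀, hz₀, hu⟩, hle, hge⟩ := hword σ hσ hσ₁ (γ t) (hγK t)
  have hnear : ∀ z ∈ K, ‖wordMap S u z - γ t‖ ≤ diam K * σ := fun z hz => by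
    rw [← hu, wordMap_sub, norm_mul, mul_comm]
    gcongr
    exact hdiam z hz z₀ hz₀
  have htA : γ t ≠ A := sub_ne_zero.1 (norm_pos_iff.1 (ht ▸ by positivity))
  refine ⟨u, hle, hge, ?_, fun z hz => (hγ t htA).trans ?_⟩
  · linarith [norm_sub_le_norm_sub_add_norm_sub (wordMap S u A) (γ t) A, hnear A hA]
  · rw [← hu]
    refine ((hK.joinedIn hc hz₀ hz).map (continuous_wordMap S u)).mono ?_
    rintro _ ⟨z, hz, rfl⟩
    refine ⟨hK.wordMap_mem u hz, fun h : wordMap S u z = A => ?_⟩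
    have := hnear z hz
    rw [h, norm_sub_rev, ht] at this
    nlinarith

theorem exists_continuous_wordMap_eq (S : Fin m → ContractingSimilarity) (u u' : List (Fin m))
    (A : ℂ) : ∃ h : ℂ → ℂ, Continuous h ∧ (∀ z, wordMap S u (h z) = wordMap S u' z) ∧
      ∀ z, ‖wordMult S u‖ * ‖h z - z‖ ≤
        ‖wordMult S u - wordMult S u'‖ * ‖z - A‖ + ‖wordMap S u A - wordMap S u' A‖ := by
  have hu := wordMult_ne_zero S u
  have hcont := continuous_wordMap S u'
  set h : ℂ → ℂ := fun z => A + (wordMap S u' z - wordMap S u A) / wordMult S u with hh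
  have hS : ∀ z, wordMap S u (h z) = wordMap S u' z := fun z => by
    rw [hh, wordMap_add, mul_div_cancel₀ _ hu, add_sub_cancel]
  refine ⟨h, by fun_prop, hS, fun z => ?_⟩
  have hdiff : wordMult S u * (h z - z) = (wordMult S u' - wordMult S u) * (z - A) +
      (wordMap S u' A - wordMap S u A) := by
    linear_combination hS z - wordMap_sub S u (h z) z + wordMap_sub S u' z A - wordMap_sub S u z A
  rw [← norm_mul, hdiff, norm_sub_rev (wordMult S u), norm_sub_rev (wordMap S u A), ← norm_mul]
  exact norm_add_le _ _

theorem IsAttractor.exists_wordMap_eq (hK : IsAttractor S K) (hc : IsConnected K) (hA : A ∈ K)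
    {x : Fin 3 → ℂ} (hx : ∀ i, x i ∈ K \ {A})
    (hno : ∀ i j, i ≠ j → ¬ JoinedIn (K \ {A}) (x i) (x j)) :
    ∃ η > 0, ∀ u u', ‖wordMult S u - wordMult S u'‖ * diam K +
      ‖wordMap S u A - wordMap S u' A‖ < η * ‖wordMult S u‖ →
        ∃ z ∈ K, ∃ z' ∈ K, wordMap S u z = wordMap S u' z' := by
  obtain ⟨η, hη, hmeet⟩ := exists_forall_norm_sub_lt_imp_exists_mem (fun i => (hx i).2)
    (fun i => hK.joinedIn hc (hx i).1 hA) hno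
  refine ⟨η, hη, fun u u' hclose => ?_⟩
  obtain ⟨h, hh, hS, hle⟩ := exists_continuous_wordMap_eq S u u' A
  obtain ⟨z, hz, hhz⟩ := hmeet h hh fun z hz => by
    refine lt_of_mul_lt_mul_left (((hle z).trans ?_).trans_lt (mul_comm η _ ▸ hclose))
      (norm_nonneg (wordMult S u))
    gcongr
    exact dist_eq_norm z A ▸ dist_le_diam_of_mem hK.2.1.isBounded hz hA
  exact ⟨h z, hhz, z, hz, hS z⟩

-- Infinitely many components would contain, at a common scale, pieces of `K` with almost the same
-- similarity; by the previous lemma two such pieces meet.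
theorem IsAttractor.exists_joinedIn_diff_singleton (hK : IsAttractor S K) (hc : IsConnected K)
    (hA : A ∈ K) {x : ℕ → ℂ} (hx : ∀ n, x n ∈ K \ {A}) :
    ∃ i j, i < j ∧ JoinedIn (K \ {A}) (x i) (x j) := by
  by_contra! hlt
  have hno : ∀ i j, i ≠ j → ¬ JoinedIn (K \ {A}) (x i) (x j) := fun i j hij h =>
    hij.lt_or_gt.elim (fun hij => hlt i j hij h) (fun hij => hlt j i hij h.symm)
  obtain ⟨η, hη, hmeet⟩ := hK.exists_wordMap_eq hc hA (x := fun i : Fin 3 => x i)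
    (fun i => hx i) (fun i j hij => hno i j (Fin.val_injective.ne hij))
  obtain ⟨r₀, hr₀, hword⟩ := hK.exists_word_joinedIn hc hA
  have hD : 0 < diam K := (dist_pos.2 (hx 0).2).trans_le
    (dist_le_diam_of_mem hK.2.1.isBounded (hx 0).1 hA)
  obtain ⟨N, hN⟩ := exists_norm_sub_lt_of_norm_le (E := ℂ × ℂ) (max 1 (3 * diam K))
    (ε := r₀ * η / (diam K + 1)) (by positivity)
  obtain ⟨n₀, hn₀⟩ := Finite.exists_min fun n : Fin (N + 1) => ‖x n - A‖
  have hn₀A : 0 < ‖x n₀ - A‖ := norm_pos_iff.2 (sub_ne_zero.2 (hx n₀).2)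
  set σ := ‖x n₀ - A‖ / (2 * diam K)
  have hσ₀ : 0 < σ := by positivity
  choose u hle hge hnear hjoin using fun n : Fin (N + 1) => hword (x n) (hx n).1 (hx n).2 σ hσ₀
    ((mul_div_cancel₀ _ (by positivity)).trans_le (hn₀ n))
  obtain ⟨n, n', hnn, hclose⟩ := hN σ hσ₀ (fun n => (wordMult S (u n), wordMap S (u n) A - A))
    fun n => by
      rw [Prod.norm_mk, max_mul_of_nonneg _ _ hσ₀.le, one_mul]
      exact max_le_max (hge n) (hnear n)
  rw [Prod.mk_sub_mk, Prod.norm_mk, max_lt_iff, sub_sub_sub_cancel_right] at hclose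
  obtain ⟨z, hz, z', hz', heq⟩ := hmeet (u n) (u n') <| calc
    _ < r₀ * η / (diam K + 1) * σ * diam K + r₀ * η / (diam K + 1) * σ :=
      add_lt_add_of_le_of_lt (by gcongr; exact hclose.1.le) hclose.2
    _ = η * (r₀ * σ) := by field_simp
    _ ≤ η * ‖wordMult S (u n)‖ := by gcongr; exact hle n
  exact hno n n' (Fin.val_injective.ne hnn) ((hjoin n z hz).trans (heq ▸ (hjoin n' z' hz').symm))

end Components

/-! ### Existence of a parameter -/

theorem exists_isParameter_of_joinedIn {m : ℕ} {S : Fin m → ContractingSimilarity} {K : Set ℂ}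
    {w : List (Fin m)} {A x : ℂ} (hw : w ≠ []) (hA : wordMap S w A = A)
    (h : JoinedIn (K \ {A}) x (wordMap S w x)) : ∃ lam, IsParameter S K A lam := by
  have hz : A + Complex.exp (Complex.log (x - A)) = x := by
    rw [Complex.exp_log (sub_ne_zero.2 h.source_mem.2), add_sub_cancel]
  generalize Complex.log (x - A) = z at hz
  obtain ⟨z', hzz', hz'⟩ := exists_joinedIn_logLift h hz
  refine ⟨_, isParameter_of_joinedIn_logLift (v := z' - z) hw hA ?_ (by rwa [add_sub_cancel])⟩
  rw [← hz, wordMap_add, hA, add_right_inj] at hz'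
  rw [Complex.exp_sub, hz', mul_div_cancel_right₀ _ (Complex.exp_ne_zero z)]

theorem IsAttractor.exists_isParameter {m : ℕ} {S : Fin m → ContractingSimilarity} {K : Set ℂ}
    (hK : IsAttractor S K) (hc : IsConnected K) (hnt : K.Nontrivial) {w : List (Fin m)}
    (hw : w ≠ []) {A : ℂ} (hA : wordMap S w A = A) : ∃ lam, IsParameter S K A lam := by
  obtain ⟨x, hx, hxA⟩ := hnt.exists_ne A
  have horbit : ∀ n, (PolygonalSystem.wordMap S w)^[n] x ∈ K \ {A} := fun n => by
    refine ⟨wordMap_flatten_replicate S w n ▸ hK.wordMap_mem _ hx, sub_ne_zero.1 ?_⟩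
    rw [iterate_wordMap_sub hA]
    exact mul_ne_zero (pow_ne_zero n (wordMult_ne_zero S w)) (sub_ne_zero.2 hxA)
  obtain ⟨i, j, hij, hjoin⟩ :=
    hK.exists_joinedIn_diff_singleton hc (hK.mem_of_wordMap_eq hw hA) horbit
  obtain ⟨k, rfl⟩ := Nat.exists_eq_add_of_lt hij
  have hmap := wordMap_flatten_replicate S w (k + 1)
  refine exists_isParameter_of_joinedIn (w := (List.replicate (k + 1) w).flatten)
    (by simpa using hw) (by rw [hmap, Function.iterate_fixed hA])
      (x := (PolygonalSystem.wordMap S w)^[i] x) ?_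
  rwa [hmap, ← Function.iterate_add_apply, add_comm, ← add_assoc]

theorem IsAttractor.subset_of_subset_iUnion_image {m : ℕ} {S : Fin m → ContractingSimilarity}
    {K V : Set ℂ} (hK : IsAttractor S K) (hV : V.Finite) (hVS : V ⊆ ⋃ k, S k '' V) : V ⊆ K := by
  intro z hz
  obtain ⟨p, hp, hmax⟩ := exists_max_image V (infDist · K) hV ⟨z, hz⟩
  obtain ⟨k, p', hp', rfl⟩ := mem_iUnion.1 (hVS hp)
  have hle : infDist (S k p') K ≤ ‖(S k).mult‖ * infDist (S k p') K :=
    (infDist_le_mul_infDist (S := fun k => S k) (S k).lipschitzWith hK.1 hK.2.1 hK.2.2 p').trans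
      (mul_le_mul_of_nonneg_left (hmax p' hp') (norm_nonneg _))
  refine (hK.2.1.isClosed.mem_iff_infDist_zero hK.1).2 (le_antisymm ?_ infDist_nonneg)
  nlinarith [hmax z hz, (S k).norm_mult_lt_one]

theorem IsGeneralizedPolygonalSystem.nontrivial {n m : ℕ} {P : Polygon ℂ n}
    {S : Fin m → ContractingSimilarity} {K : Set ℂ} (hS : IsGeneralizedPolygonalSystem P S)
    (hK : IsAttractor S K) : K.Nontrivial := by
  obtain ⟨hn, hinj, -⟩ := hS.simple
  have : Nontrivial (Fin n) := Fin.nontrivial_iff_two_le.2 (by omega)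
  exact (image_univ ▸ nontrivial_univ.image hinj).mono
    (hK.subset_of_subset_iUnion_image (finite_range _) hS.vertices_subset)

end PolygonalSystem

theorem theorem20_general {n m : ℕ} (P : Polygon ℂ n)
    (S : Fin m → PolygonalSystem.ContractingSimilarity) (K : Set ℂ)
    (hK : PolygonalSystem.IsAttractor S K) (hc : IsConnected K) (hnt : K.Nontrivial)
    (hcirc : ¬∃ c : Circle → ℂ, Continuous c ∧ Function.Injective c ∧ Set.range c ⊆ K) :
    PolygonalSystem.ParameterMatchingCondition P S K := by
  refine ⟨fun A ⟨_, w, hw, hwA⟩ => ?_, fun B _ A A' _ _ i j _ _ hi hj lam lam' h h' =>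
    h.eq_of_wordMap_eq hK hcirc h' (hi.trans hj.symm)⟩
  obtain ⟨lam, hlam⟩ := hK.exists_isParameter hc hnt hw hwA
  exact ⟨lam, hlam, fun lam' h' => h'.eq_of_wordMap_eq hK hcirc hlam (u := []) (u' := []) rfl⟩

theorem theorem20 {n n' m : ℕ} (P : Polygon ℂ n) (P' : Polygon ℂ n')
    (S S' : Fin m → PolygonalSystem.ContractingSimilarity) (δ : ℝ) (hδ : 0 < δ)
    (hS : PolygonalSystem.IsContractiblePolygonalSystem P S)
    (hS' : PolygonalSystem.IsGeneralizedPolygonalSystem P' S')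
    (hdef : PolygonalSystem.IsDeformation δ P S P' S')
    (K' : Set ℂ) (hK' : PolygonalSystem.IsAttractor S' K')
    (hdend : PolygonalSystem.IsDendrite K') :
    PolygonalSystem.ParameterMatchingCondition P' S' K' :=
  theorem20_general P' S' K' hK' hdend.2.1 (hS'.nontrivial hK') hdend.2.2.2
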